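/- **Setting.** Let $\mathcal F$ be a signature of symbols of finite arity and $\mathcal V$ an infinite set of variables. A *CCTRS* $\mathcal R$ over $\mathcal F$ is a set of conditional rules $\rho\colon f(\ell_1,\dots,\ell_n)\to r\Leftarrow a_1\approx b_1,\dots,a_k\approx b_k$ ($k\ge 0$) such that, calling a symbol *defined* if it is the root of a left-hand side and a *constructor* otherwise, $\ell_1,\dots,\ell_n,b_1,\dots,b_k$ are constructor terms (built from constructors and variables), the terms $f(\ell_1,\dots,\ell_n),b_1,\dots,b_k$ pairwise share no variables, $\mathrm{Var}(r)\subseteq \mathrm{Var}(\ell_1,\dots,\ell_n,b_1,\dots,b_k)$, and $\mathrm{Var}(a_i)\subseteq\mathrm{Var}(\ell_1,\dots,\ell_n,b_1,\dots,b_{i-1})$ for $1\le i\le k$. Let $\mathcal R{\restriction}f$ be the set of rules whose left-hand side has root $f$. $\mathcal R$ is *strong* if every $\mathcal R{\restriction}f$ is finite and, for every rule, $f(\ell_1,\dots,\ell_n)$ and $b_1,\dots,b_k$ are linear. **Labeled reduction.** The labeled signature $\mathcal G$ consists of the constructors and the symbols $f_L$ for $f$ defined and $L\subseteq\mathcal R{\restriction}f$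 (with the arity of $f$). The map $\mathsf{label}$ replaces each defined $f$ by $f_{\mathcal R\restriction f}$. A *labeled normal form* is a term over $\mathcal G$ all of whose labels are empty. *Complexity-conscious steps* $s\rightharpoonup t$ between labeled terms, with their costs, and *complexity-conscious reductions* $\rightharpoonup^*$ (finite sequences of such steps, including the empty one, whose cost is the sum of the costs of the steps) are defined by mutual induction. There is a step from $s$ to $t$ in the following cases, where $p$ is a position of $s$, $s|_p=f_L(s_1,\dots,s_n)$, and $\rho\in L$ is as above. * *Matching failure* (cost $0$): $t=s[f_{L\setminus\{\rho\}}(s_1,\dots,s_n)]_p$, and $s|_p$ is an instance of a linear term $f_L(u_1,\dots,u_n)$, where the $u_i$ are labeled normal forms with variables not occurring in $\rho$'s left-hand side, such that $f(u_1,\dots,u_n)$ and $f(\ell_1,\dots,\ell_n)$ are not unifiable. * *Success*: for some substitution $\sigma$, $s_i=\ell_i\sigma$ for all $i$, there are complexity-conscious reductions $\mathsf{label}(a_i)\sigma\rightharpoonup^* b_i\sigma$ of cost $c_i$ for $1\le i\le k$, and $t=s[\mathsf{label}(r)\sigma]_p$; the cost is $1+c_1+\dots+c_k$. * *Failure*: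 for some substitution $\sigma$ and some $0\le j<k$, $s_i=\ell_i\sigma$ for all $i$, there are complexity-conscious reductions $\mathsf{label}(a_i)\sigma\rightharpoonup^* b_i\sigma$ of cost $c_i$ for $1\le i\le j$ and $\mathsf{label}(a_{j+1})\sigma\rightharpoonup^* u\tau$ of cost $d$, where $\tau$ is a substitution and $u$ is a linear labeled normal form that shares no variable with $b_{j+1}$ and is not unifiable with it, and $t=s[f_{L\setminus\{\rho\}}(s_1,\dots,s_n)]_p$; the cost is $c_1+\dots+c_j+d$. Write $s\mathrel{\rightharpoonup_{\rhd}}t$ if, for some $p$, $f$, $L$, $\rho\in L$, $\sigma$ and $0\le j<k$, $s|_p=f_L(\ell_1\sigma,\dots,\ell_n\sigma)$, $\mathsf{label}(a_i)\sigma\rightharpoonup^* b_i\sigma$ for $1\le i\le j$, and $t=\mathsf{label}(a_{j+1})\sigma$. Write $s\rightharpoonup^\infty$ if there is an infinite sequence $s=s_0,s_1,s_2,\dots$ with $s_i\rightharpoonup s_{i+1}$ or $s_i\mathrel{\rightharpoonup_{\rhd}}s_{i+1}$ for all $i$. **The system $\Xi(\mathcal R)$.** Let $\mathcal R$ be strong,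 and for each $f$ enumerate $\mathcal R{\restriction}f=\{\rho_1,\dots,\rho_{m}\}$, $m=m_f$. The signature $\mathcal H$ has constants $\bot,\top$; for each $n$-ary $f\in\mathcal F$ a symbol $f$ of arity $n+m_f$, whose first $n$ arguments are active; and for each rule $\rho_i$ of $f$ with $k$ conditions and each $1\le j\le k$ a symbol $f_i^j$ of arity $n+m_f+j-1$, whose only active argument is number $n+i+j-1$. Write $\langle \vec t\,\rangle[\vec u]_i$ for the sequence $\vec t$ with its $i$-th entry replaced by the sequence $\vec u$. For $\star\in\{\top,\bot\}$ let $\xi_\star$ add to each defined symbol $f$ the additional arguments $\star,\dots,\star$. For a linear constructor term $t$ the set $\mathrm{AP}(t)$ of anti-patterns is empty if $t$ is a variable, and for $t=f(t_1,\dots,t_n)$ it consists of the terms $g(x_1,\dots,x_{m'})$ for constructors $g\ne f$, the terms $g(x_1,\dots,x_{m'},\bot,\dots,\bot)$ for defined $g$, and the terms $f(x_1,\dots,x_{i-1},u,x_{i+1},\dots,x_n)$ with $u\in\mathrm{AP}(t_i)$, where the $x_j$ are fresh and pairwise distinct variables. For each $\rho_i\colon f(\vec\ell\,)\to r\Leftarrow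 a_1\approx b_1,\dots,a_k\approx b_k$, with fresh pairwise distinct variables $\vec x=x_1,\dots,x_{m_f}$ and $\vec y=y_1,\dots,y_n$ and with anti-patterns $v$ on fresh variables, $\Xi(\mathcal R)$ has the rules 1. $f(\vec\ell,\langle\vec x\rangle[\top]_i)\to\xi_\top(r)$ if $k=0$ (cost 1); 2. $f(\vec\ell,\langle\vec x\rangle[\top]_i)\to f_i^1(\vec\ell,\langle\vec x\rangle[\xi_\top(a_1)]_i)$ if $k>0$ (cost 0); 3. $f_i^k(\vec\ell,\langle\vec x\rangle[b_1,\dots,b_k]_i)\to\xi_\top(r)$ if $k>0$ (cost 1); 4. $f_i^j(\vec\ell,\langle\vec x\rangle[b_1,\dots,b_j]_i)\to f_i^{j+1}(\vec\ell,\langle\vec x\rangle[b_1,\dots,b_j,\xi_\top(a_{j+1})]_i)$ for $1\le j<k$ (cost 0); 5. $f_i^j(\vec\ell,\langle\vec x\rangle[b_1,\dots,b_{j-1},v]_i)\to f(\vec\ell,\langle\vec x\rangle[\bot]_i)$ for $1\le j\le k$, $v\in\mathrm{AP}(b_j)$ (cost 0); 6. $f(\langle\vec y\rangle[v]_j,\langle\vec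 x\rangle[\top]_i)\to f(\langle\vec y\rangle[v]_j,\langle\vec x\rangle[\bot]_i)$ for $1\le j\le n$, $v\in\mathrm{AP}(\ell_j)$ (cost 0). A $(\Xi(\mathcal R),\mu)$ step rewrites with these rules at an active position, i.e. one reached from the root through active arguments only; the cost of a reduction is the sum of the costs of its steps; a term is terminating if no infinite $(\Xi(\mathcal R),\mu)$ reduction starts from it. Finally $\zeta$ maps labeled terms to terms over $\mathcal H$: it keeps variables and constructors, and $\zeta(f_L(t_1,\dots,t_n))=f(\zeta(t_1),\dots,\zeta(t_n),c_1,\dots,c_{m_f})$ with $c_i=\top$ if $\rho_i\in L$ and $c_i=\bot$ otherwise. **Theorem.** Let $\mathcal R$ be a strong CCTRS and let $s$ be a ground labeled term. 1. If $\zeta(s)$ is terminating and there is a context-sensitive reduction $\zeta(s)\to^*_{\Xi(\mathcal R),\mu}t$ of cost $N$ for some $t$, then there is a complexity-conscious reduction $s\rightharpoonup^* t'$, for some $t'$, of cost at least $N$. 2. If there is an infinite $(\Xi(\mathcal R),\mu)$ reduction starting from $\zeta(s)$, then $s\rightharpoonup^\infty$. -/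

import Mathlib

universe u w v

namespace CondRew

/-! ### Signatures, terms, substitutions, rewriting in a context -/

/-- A signature. The argument positions of a symbol `f` are the elements of `Pos f`, so the arity
of `f` is the cardinality of `Pos f`; for an ordinary `n`-ary symbol take `Pos f = Fin n`. -/
structure Signature where
  Sym : Type u
  Pos : Sym → Type w

/-- Every symbol has a finite arity. -/
def Signature.Finitary (S : Signature.{u, w}) : Prop := ∀ f, Finite (S.Pos f)

/-- Terms over a signature `S` and variables `V`. -/
inductive Term (S : Signature.{u, w}) (V : Type v) : Type (max u w v)
  | var (x : V) : Term S V
  | app (f : S.Sym) (ts : S.Pos f → Term S V) : Term S V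

namespace Term

variable {S : Signature.{u, w}} {V : Type v}

/-- The set of variables of a term. -/
def vars : Term S V → Set V
  | var x => {x}
  | app _ ts => ⋃ i, vars (ts i)

/-- Ground terms: terms without variables. -/
def Ground (t : Term S V) : Prop := t.vars = ∅

/-- Application of a substitution. -/
def subst (σ : V → Term S V) : Term S V → Term S V
  | var x => σ x
  | app f ts => app f (fun i => subst σ (ts i))

/-- Linear terms: no variable occurs more than once. -/
def Linear : Term S V → Prop
  | var _ => True
  | app _ ts => (∀ i, Linear (ts i)) ∧ ∀ i j, i ≠ j → Disjoint (vars (ts i)) (vars (ts j))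

/-- All function symbols of the term satisfy `P`. -/
def AllSym (P : S.Sym → Prop) : Term S V → Prop
  | var _ => True
  | app f ts => P f ∧ ∀ i, AllSym P (ts i)

/-- Two terms are unifiable. -/
def Unifiable (s t : Term S V) : Prop := ∃ θ : V → Term S V, s.subst θ = t.subst θ

/-- `Subterm u s`: there is a position `p` of `s` with `s|_p = u`. -/
inductive Subterm (u : Term S V) : Term S V → Prop
  | refl : Subterm u u
  | arg (f : S.Sym) (ts : S.Pos f → Term S V) (i : S.Pos f) :
      Subterm u (ts i) → Subterm u (app f ts)

/-- `Replace μ u u' s t`: there is a position `p` of `s`, active with respect to the replacement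
map `μ`, such that `s|_p = u` and `t = s[u']_p`. -/
inductive Replace (μ : ∀ f : S.Sym, Set (S.Pos f)) (u u' : Term S V) :
    Term S V → Term S V → Prop
  | root : Replace μ u u' u u'
  | arg (f : S.Sym) (ts ts' : S.Pos f → Term S V) (i : S.Pos f) :
      i ∈ μ f → Replace μ u u' (ts i) (ts' i) → (∀ j, j ≠ i → ts' j = ts j) →
      Replace μ u u' (app f ts) (app f ts')

/-- `ReplaceAny u u' s t`: there is a position `p` of `s` with `s|_p = u` and `t = s[u']_p`. -/
def ReplaceAny (u u' s t : Term S V) : Prop := Replace (fun _ => Set.univ) u u' s t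

end Term

/-! ### Conditional rewrite systems -/

/-- A conditional rule `f(args) → rhs ⇐ a 0 ≈ b 0, …, a (k-1) ≈ b (k-1)` for the symbol `f`. -/
structure Rule (F : Signature.{u, w}) (V : Type v) (f : F.Sym) : Type (max u w v) where
  args : F.Pos f → Term F V
  rhs : Term F V
  k : ℕ
  a : Fin k → Term F V
  b : Fin k → Term F V

/-- The left-hand side `f(args)` of a rule. -/
def Rule.lhs {F : Signature.{u, w}} {V : Type v} {f : F.Sym} (ρ : Rule F V f) : Term F V :=
  Term.app f ρ.args

/-- A conditional rewrite system, presented by the sets `R f` of its rules whose left-hand side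
has root symbol `f`. -/
abbrev CTRS (F : Signature.{u, w}) (V : Type v) := ∀ f : F.Sym, Set (Rule F V f)

variable {F : Signature.{u, w}} {V : Type v}

/-- Defined symbols are the root symbols of left-hand sides; all others are constructors. -/
def Defined (R : CTRS F V) (f : F.Sym) : Prop := (R f).Nonempty

/-- Constructor terms: built from constructor symbols and variables. -/
def ConstructorTerm (R : CTRS F V) (t : Term F V) : Prop := t.AllSym (fun f => ¬ Defined R f)

/-- Constructor-based deterministic 3-CTRSs in which the right-hand sides of conditions use only
variables that occur neither in the left-hand side nor in the right-hand sides of other conditions. -/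
structure IsCCTRS (R : CTRS F V) : Prop where
  args_constructor : ∀ f, ∀ ρ ∈ R f, ∀ i, ConstructorTerm R (ρ.args i)
  b_constructor : ∀ f, ∀ ρ ∈ R f, ∀ i, ConstructorTerm R (ρ.b i)
  lhs_disjoint : ∀ f, ∀ ρ ∈ R f, ∀ i, Disjoint ρ.lhs.vars (ρ.b i).vars
  b_disjoint : ∀ f, ∀ ρ ∈ R f, ∀ i j, i ≠ j → Disjoint (ρ.b i).vars (ρ.b j).vars
  rhs_vars : ∀ f, ∀ ρ ∈ R f, ρ.rhs.vars ⊆ ρ.lhs.vars ∪ ⋃ i, (ρ.b i).vars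
  a_vars : ∀ f, ∀ ρ ∈ R f, ∀ i, (ρ.a i).vars ⊆ ρ.lhs.vars ∪ ⋃ j, ⋃ (_ : j < i), (ρ.b j).vars

/-- Strong CCTRSs: semi-finite, with linear left-hand sides and linear right-hand sides of
conditions. -/
structure IsStrongCCTRS (R : CTRS F V) : Prop extends IsCCTRS R where
  semifinite : ∀ f, (R f).Finite
  lhs_linear : ∀ f, ∀ ρ ∈ R f, ρ.lhs.Linear
  b_linear : ∀ f, ∀ ρ ∈ R f, ∀ i, (ρ.b i).Linear

/-! ### Labeled terms and complexity-conscious reduction -/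

/-- The labeled signature: symbols `f_L` with `L` a set of rules of `f`. A constructor symbol `f`
has no rules, so `f_∅` is its only labeled version; it is identified with `f`. -/
abbrev LSig (R : CTRS F V) : Signature where
  Sym := Σ f : F.Sym, Set (R f)
  Pos := fun g => F.Pos g.1

/-- Labeled terms. -/
abbrev LTerm (R : CTRS F V) := Term (LSig R) V

/-- The labeled term `f_L(ts)`. -/
abbrev lapp (R : CTRS F V) (f : F.Sym) (L : Set (R f)) (ts : F.Pos f → LTerm R) : LTerm R :=
  Term.app (S := LSig R) ⟨f, L⟩ ts

/-- `label` labels every symbol `f` with the set of all its rules. On constructor terms it is the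
identification of unlabeled with labeled constructor terms. -/
def label (R : CTRS F V) : Term F V → LTerm R
  | .var x => .var x
  | .app f ts => lapp R f Set.univ (fun i => label R (ts i))

/-- Labeled normal forms: all labels are empty. -/
def LabeledNF (R : CTRS F V) (t : LTerm R) : Prop := t.AllSym (fun g : (LSig R).Sym => g.2 = ∅)

mutual

/-- `LStep R s t n`: there is a complexity-conscious step from `s` to `t` of cost `n`. -/
inductive LStep (R : CTRS F V) : LTerm R → LTerm R → ℕ → Prop
  /-- Matching failure: the redex is an instance of some linear `f_L(us)`, with labeled normal
  forms `us` on fresh variables, that does not unify with the left-hand side. -/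
  | bot (s t : LTerm R) (f : F.Sym) (L : Set (R f)) (ρ : R f) (us : F.Pos f → LTerm R)
      (σ : V → LTerm R) :
      ρ ∈ L →
      (∀ i, LabeledNF R (us i)) →
      (lapp R f L us).Linear →
      Disjoint (lapp R f L us).vars ρ.1.lhs.vars →
      ¬ Term.Unifiable (lapp R f L us) (lapp R f L (fun i => label R (ρ.1.args i))) →
      Term.ReplaceAny ((lapp R f L us).subst σ) ((lapp R f (L \ {ρ}) us).subst σ) s t →
      LStep R s t 0
  /-- Successful step: all conditions are satisfied. -/
  | success (s t : LTerm R) (f : F.Sym) (L : Set (R f)) (ρ : R f) (σ : V → LTerm R)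
      (c : Fin ρ.1.k → ℕ) :
      ρ ∈ L →
      (∀ i, LRed R ((label R (ρ.1.a i)).subst σ) ((label R (ρ.1.b i)).subst σ) (c i)) →
      Term.ReplaceAny (lapp R f L (fun i => (label R (ρ.1.args i)).subst σ))
        ((label R ρ.1.rhs).subst σ) s t →
      LStep R s t (1 + ∑ i, c i)
  /-- Failed step: the conditions before the condition `j` are satisfied, and condition `j` fails
  because its left-hand side reduces to an instance of a linear labeled normal form that does not
  unify with its right-hand side (after renaming variables apart). -/
  | fail (s t : LTerm R) (f : F.Sym) (L : Set (R f)) (ρ : R f) (σ : V → LTerm R)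
      (j : Fin ρ.1.k) (c : Fin ρ.1.k → ℕ) (d : ℕ) (u : LTerm R) (τ : V → LTerm R) :
      ρ ∈ L →
      (∀ i, i < j →
        LRed R ((label R (ρ.1.a i)).subst σ) ((label R (ρ.1.b i)).subst σ) (c i)) →
      LabeledNF R u →
      u.Linear →
      Disjoint u.vars (ρ.1.b j).vars →
      ¬ Term.Unifiable u (label R (ρ.1.b j)) →
      LRed R ((label R (ρ.1.a j)).subst σ) (u.subst τ) d →
      Term.ReplaceAny (lapp R f L (fun i => (label R (ρ.1.args i)).subst σ))
        (lapp R f (L \ {ρ}) (fun i => (label R (ρ.1.args i)).subst σ)) s t →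
      LStep R s t ((∑ i ∈ Finset.Iio j, c i) + d)

/-- `LRed R s t n`: there is a complexity-conscious reduction from `s` to `t` of cost `n`, the sum
of the costs of its steps. -/
inductive LRed (R : CTRS F V) : LTerm R → LTerm R → ℕ → Prop
  | refl (s : LTerm R) : LRed R s s 0
  | head (s t u : LTerm R) (m n : ℕ) : LStep R s t m → LRed R t u n → LRed R s u (m + n)

end

/-- A step into a condition: some subterm of `s` matches a rule `ρ` in its label, the conditions
before `j` are satisfied, and `t` is the instantiated left-hand side of condition `j`. -/
def LCondStep (R : CTRS F V) (s t : LTerm R) : Prop :=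
  ∃ (f : F.Sym) (L : Set (R f)) (ρ : R f) (σ : V → LTerm R) (j : Fin ρ.1.k),
    ρ ∈ L ∧
    Term.Subterm (lapp R f L (fun i => (label R (ρ.1.args i)).subst σ)) s ∧
    (∀ i, i < j → ∃ n, LRed R ((label R (ρ.1.a i)).subst σ) ((label R (ρ.1.b i)).subst σ) n) ∧
    t = (label R (ρ.1.a j)).subst σ

/-- There is an infinite sequence of labeled steps and steps into conditions from `s`. -/
def LInfinite (R : CTRS F V) (s : LTerm R) : Prop :=
  ∃ q : ℕ → LTerm R, q 0 = s ∧
    ∀ i, (∃ n, LStep R (q i) (q (i + 1)) n) ∨ LCondStep R (q i) (q (i + 1))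

/-! ### The context-sensitive system `Ξ(R)` -/

/-- The symbols of the transformed signature; `cond f ρ j` is the symbol that marks the evaluation
of condition `j` of the rule `ρ` of `f`. -/
inductive HSym (R : CTRS F V) : Type (max u w v)
  | bot : HSym R
  | top : HSym R
  | fn (f : F.Sym) : HSym R
  | cond (f : F.Sym) (ρ : R f) (j : Fin ρ.1.k) : HSym R

/-- Argument positions. The symbol `f` gets one additional argument for each of its rules. In
`cond f ρ j` the additional argument for `ρ` is replaced by one argument for each of the
conditions up to and including `j`. -/
abbrev HPos (R : CTRS F V) : HSym R → Type (max u w v)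
  | .bot => PEmpty
  | .top => PEmpty
  | .fn f => F.Pos f ⊕ R f
  | .cond f ρ j => F.Pos f ⊕ ({ρ' : R f // ρ' ≠ ρ} ⊕ {l : Fin ρ.1.k // l ≤ j})

/-- The transformed signature. -/
abbrev HSig (R : CTRS F V) : Signature where
  Sym := HSym R
  Pos := HPos R

/-- Terms over the transformed signature. -/
abbrev HTerm (R : CTRS F V) := Term (HSig R) V

/-- The replacement map: the original arguments of `f` are active; in `cond f ρ j` only the
argument for condition `j` is active. -/
def mu (R : CTRS F V) : ∀ g : HSym R, Set (HPos R g)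
  | .bot => ∅
  | .top => ∅
  | .fn _ => Set.range Sum.inl
  | .cond _ _ j => {Sum.inr (Sum.inr ⟨j, le_rfl⟩)}

/-- The constant `⊥`. -/
def hbot (R : CTRS F V) : HTerm R := Term.app (S := HSig R) HSym.bot PEmpty.elim

/-- The constant `⊤`. -/
def htop (R : CTRS F V) : HTerm R := Term.app (S := HSig R) HSym.top PEmpty.elim

/-- The term `f(ts, es)`, where `es ρ` is the additional argument for the rule `ρ`. -/
def hfn (R : CTRS F V) (f : F.Sym) (ts : F.Pos f → HTerm R) (es : R f → HTerm R) : HTerm R :=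
  Term.app (S := HSig R) (HSym.fn f) (Sum.elim ts es)

/-- The term with root `cond f ρ j` and arguments `ts`, `es` without the entry for `ρ`, and the
entries of `cs` up to and including `j`. -/
def hcond (R : CTRS F V) (f : F.Sym) (ρ : R f) (j : Fin ρ.1.k) (ts : F.Pos f → HTerm R)
    (es : R f → HTerm R) (cs : Fin ρ.1.k → HTerm R) : HTerm R :=
  Term.app (S := HSig R) (HSym.cond f ρ j)
    (Sum.elim ts (Sum.elim (fun ρ' => es ρ'.1) (fun l => cs l.1)))

/-- The map `ξ_star`, where `star` is `hbot R` or `htop R`. On constructor terms it is the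
identification of terms over the original signature with terms over the transformed one. -/
def xi (R : CTRS F V) (star : HTerm R) : Term F V → HTerm R
  | .var x => .var x
  | .app f ts => hfn R f (fun i => xi R star (ts i)) (fun _ => star)

open Classical in
/-- The translation `ζ` of labeled terms: the additional argument for `ρ` is `⊤` if `ρ` belongs to
the label and `⊥` otherwise. -/
noncomputable def zeta (R : CTRS F V) : LTerm R → HTerm R
  | .var x => .var x
  | .app g ts => hfn R g.1 (fun i => zeta R (ts i)) (fun ρ => if ρ ∈ g.2 then htop R else hbot R)

open Classical in
/-- `AP R t v`: `v` is an anti-pattern of the linear constructor term `t`. All choices of fresh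
variables are included, so the set of anti-patterns is closed under renaming. A defined symbol is
always different from the root `f` of a constructor term, and a constructor symbol has no
additional arguments. -/
inductive AP (R : CTRS F V) : Term F V → HTerm R → Prop
  | other (f : F.Sym) (ts : F.Pos f → Term F V) (g : F.Sym) (x : F.Pos g → V) :
      g ≠ f → Function.Injective x →
      AP R (.app f ts) (hfn R g (fun i => .var (x i)) (fun _ => hbot R))
  | arg (f : F.Sym) (ts : F.Pos f → Term F V) (i : F.Pos f) (u : HTerm R) (x : F.Pos f → V) :
      AP R (ts i) u → Function.Injective x → (∀ j, x j ∉ u.vars) →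
      AP R (.app f ts)
        (hfn R f (Function.update (fun j => .var (x j)) i u) (fun _ => hbot R))

/-- `x` is a family of pairwise distinct variables, indexed by the rules of `f`, that occur neither
in the left-hand side of `ρ` nor in the right-hand sides of its conditions. -/
def FreshFor (R : CTRS F V) (f : F.Sym) (ρ : R f) (x : R f → V) : Prop :=
  Function.Injective x ∧ ∀ ρ', x ρ' ∉ ρ.1.lhs.vars ∧ ∀ i, x ρ' ∉ (ρ.1.b i).vars

open Classical in
/-- `XiRule R l r n`: `l → r` is a rule of `Ξ(R)` of cost `n`. All choices of fresh variables are
included. -/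
inductive XiRule (R : CTRS F V) : HTerm R → HTerm R → ℕ → Prop
  /-- An unconditional rule. -/
  | rule1 (f : F.Sym) (ρ : R f) (x : R f → V) :
      FreshFor R f ρ x → ρ.1.k = 0 →
      XiRule R
        (hfn R f (fun i => xi R (htop R) (ρ.1.args i))
          (Function.update (fun ρ' => .var (x ρ')) ρ (htop R)))
        (xi R (htop R) ρ.1.rhs) 1
  /-- Start of the evaluation of the first condition. -/
  | rule2 (f : F.Sym) (ρ : R f) (x : R f → V) (j : Fin ρ.1.k) :
      FreshFor R f ρ x → j.val = 0 →
      XiRule R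
        (hfn R f (fun i => xi R (htop R) (ρ.1.args i))
          (Function.update (fun ρ' => .var (x ρ')) ρ (htop R)))
        (hcond R f ρ j (fun i => xi R (htop R) (ρ.1.args i)) (fun ρ' => .var (x ρ'))
          (fun _ => xi R (htop R) (ρ.1.a j))) 0
  /-- All conditions have succeeded. -/
  | rule3 (f : F.Sym) (ρ : R f) (x : R f → V) (j : Fin ρ.1.k) :
      FreshFor R f ρ x → j.val + 1 = ρ.1.k →
      XiRule R
        (hcond R f ρ j (fun i => xi R (htop R) (ρ.1.args i)) (fun ρ' => .var (x ρ'))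
          (fun l => xi R (htop R) (ρ.1.b l)))
        (xi R (htop R) ρ.1.rhs) 1
  /-- From condition `j` to the next condition `j'`. -/
  | rule4 (f : F.Sym) (ρ : R f) (x : R f → V) (j j' : Fin ρ.1.k) :
      FreshFor R f ρ x → j'.val = j.val + 1 →
      XiRule R
        (hcond R f ρ j (fun i => xi R (htop R) (ρ.1.args i)) (fun ρ' => .var (x ρ'))
          (fun l => xi R (htop R) (ρ.1.b l)))
        (hcond R f ρ j' (fun i => xi R (htop R) (ρ.1.args i)) (fun ρ' => .var (x ρ'))
          (Function.update (fun l => xi R (htop R) (ρ.1.b l)) j' (xi R (htop R) (ρ.1.a j')))) 0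
  /-- Condition `j` fails. -/
  | rule5 (f : F.Sym) (ρ : R f) (x : R f → V) (j : Fin ρ.1.k) (v : HTerm R) :
      FreshFor R f ρ x → AP R (ρ.1.b j) v →
      Disjoint v.vars ρ.1.lhs.vars → (∀ i, Disjoint v.vars (ρ.1.b i).vars) →
      (∀ ρ', x ρ' ∉ v.vars) →
      XiRule R
        (hcond R f ρ j (fun i => xi R (htop R) (ρ.1.args i)) (fun ρ' => .var (x ρ'))
          (Function.update (fun l => xi R (htop R) (ρ.1.b l)) j v))
        (hfn R f (fun i => xi R (htop R) (ρ.1.args i))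
          (Function.update (fun ρ' => .var (x ρ')) ρ (hbot R))) 0
  /-- The left-hand side does not match at the argument `j`. -/
  | rule6 (f : F.Sym) (ρ : R f) (x : R f → V) (y : F.Pos f → V) (j : F.Pos f) (v : HTerm R) :
      Function.Injective (Sum.elim y x) → AP R (ρ.1.args j) v →
      (∀ i, y i ∉ v.vars) → (∀ ρ', x ρ' ∉ v.vars) →
      XiRule R
        (hfn R f (Function.update (fun i => .var (y i)) j v)
          (Function.update (fun ρ' => .var (x ρ')) ρ (htop R)))
        (hfn R f (Function.update (fun i => .var (y i)) j v)
          (Function.update (fun ρ' => .var (x ρ')) ρ (hbot R))) 0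

/-- A context-sensitive `(Ξ(R), μ)` step of cost `n`. -/
def XiStep (R : CTRS F V) (s t : HTerm R) (n : ℕ) : Prop :=
  ∃ (l r : HTerm R) (σ : V → HTerm R),
    XiRule R l r n ∧ Term.Replace (mu R) (l.subst σ) (r.subst σ) s t

/-- A context-sensitive `(Ξ(R), μ)` reduction of cost `n`, the sum of the costs of its steps. -/
inductive XiRed (R : CTRS F V) : HTerm R → HTerm R → ℕ → Prop
  | refl (s : HTerm R) : XiRed R s s 0
  | head (s t u : HTerm R) (m n : ℕ) : XiStep R s t m → XiRed R t u n → XiRed R s u (m + n)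

/-- There is an infinite `(Ξ(R), μ)` reduction from `s`. -/
def XiInfinite (R : CTRS F V) (s : HTerm R) : Prop :=
  ∃ q : ℕ → HTerm R, q 0 = s ∧ ∀ i, ∃ n, XiStep R (q i) (q (i + 1)) n

/-- Termination of a term with respect to `(Ξ(R), μ)`. -/
def XiTerminating (R : CTRS F V) (s : HTerm R) : Prop := ¬ XiInfinite R s

end CondRew

namespace CondRew

-- A context-sensitive reduction evaluates the conditions of a rule in place, below a symbol `cond f
-- ρ j`, whereas a labeled step takes these evaluations as premises. The labeled term therefore
-- stays at the redex while conditions are being evaluated, and the labeled reductions found so far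
-- are stored as premises of a later success or failure step. This is the relation `Sim R s t D`;
-- the debt `D` bounds the cost already spent in `t` but not yet charged to `s`. A step of cost `n`
-- from `t` is answered by a labeled reduction of cost `M` leaving a debt `D'` with `n + D ≤ M + D'`
-- (`Sim.step`).
--
-- The difficulty is that a variable may be bound to a term which itself contains unfinished
-- conditions, and the rule may erase it. If a condition uses the variable, the debt moves into the
-- evaluation of that condition; if the resulting term keeps it, the debt stays there. Otherwise it
-- is paid just before the step, by reducing the value of the variable inside the arguments of the
-- redex or at the end of the reduction that produced an instance of some `b l`. Paying is possible
-- because, at the moment of matching, the value sits at an active position of a terminating term,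
-- so it can be rewritten to a normal form; by `Sim.progress` a representing term that admits no
-- step is the translation of a ground labeled normal form and has no debt.
--
-- For the first claim, `Sim.exists_lred` runs this along the well-founded order generated by
-- context-sensitive steps and active arguments. For the second, the contrapositive `Sim.acc` shows
-- that `t` is accessible if `s` is accessible for labeled steps and steps into conditions. A step
-- from `t` that leaves `s` unchanged either starts or advances a condition at the root, which
-- lowers `rank`, or rewrites below an active argument; so a lexicographic induction on `s`, the
-- rank and the tuple of active arguments suffices. The active arguments are themselves accessible,
-- being represented by arguments of `s` or by terms reached through a step into a condition.

open scoped Classical in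
/-- Substitutions on pairwise disjoint sets of variables have a common extension. -/
theorem exists_glue {V ι T : Type*} (A : ι → Set V) (σ : ι → V → T)
    (hA : ∀ i j, i ≠ j → Disjoint (A i) (A j)) (σ₀ : V → T) :
    ∃ τ : V → T, ∀ i, ∀ y ∈ A i, τ y = σ i y := by
  refine ⟨fun y => if h : ∃ i, y ∈ A i then σ h.choose y else σ₀ y, fun i y hy => ?_⟩
  have h : ∃ i, y ∈ A i := ⟨i, hy⟩
  have hi : h.choose = i := by
    by_contra hne
    exact Set.disjoint_left.1 (hA _ _ hne) h.choose_spec hy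
  simp only [dif_pos h]
  rw [hi]

/-- Injective families of variables that avoid a finite set. -/
theorem exists_fresh_family {V : Type*} [Infinite V] (ι : Type*) [Finite ι] (A : Set V)
    (hA : A.Finite) : ∃ x : ι → V, Function.Injective x ∧ ∀ i, x i ∉ A := by
  have : Infinite (Aᶜ : Set V) := hA.infinite_compl.to_subtype
  obtain ⟨n, ⟨e⟩⟩ := Finite.exists_equiv_fin ι
  refine ⟨fun i => (Infinite.natEmbedding (Aᶜ : Set V) (e i).val).1, ?_, fun i => ?_⟩
  · intro i j hij
    have h1 := (Infinite.natEmbedding (Aᶜ : Set V)).injective (Subtype.ext hij)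
    exact e.injective (Fin.ext h1)
  · exact (Infinite.natEmbedding (Aᶜ : Set V) (e i).val).2

/-- Accessibility of tuples that are changed in one coordinate from a finite set at a time. -/
theorem acc_tuple {ι α : Type*} (r : α → α → Prop) (S : Set ι) (hS : S.Finite) :
    ∀ a : ι → α, (∀ i ∈ S, Acc r (a i)) →
      Acc (fun a' a : ι → α => ∃ i ∈ S, r (a' i) (a i) ∧ ∀ j, j ≠ i → a' j = a j) a := by
  induction S, hS using Set.Finite.induction_on with
  | empty => exact fun a _ => ⟨_, fun a' ⟨i, hi, _⟩ => absurd hi (Set.notMem_empty i)⟩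
  | @insert i S hi _ ih =>
    -- Lexicographic induction: on the coordinate `i` first, then on the tuple with respect to
    -- changes in `S`. A change at `i` keeps the coordinates in `S` accessible, but restarts the
    -- inner induction.
    suffices h : ∀ x, Acc r x → ∀ a : ι → α, a i = x → (∀ j ∈ S, Acc r (a j)) →
        Acc (fun a' a : ι → α => ∃ k ∈ insert i S, r (a' k) (a k) ∧ ∀ j, j ≠ k → a' j = a j) a from
      fun a ha => h _ (ha i (Set.mem_insert _ _)) a rfl
        (fun j hj => ha j (Set.mem_insert_of_mem _ hj))
    intro x hx
    induction hx with
    | intro x _ ihx =>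
      intro a hax ha
      have hacc := ih a ha
      induction hacc with
      | intro a _ iha =>
        refine ⟨_, ?_⟩
        rintro a' ⟨k, hk, hr, hne⟩
        rcases Set.mem_insert_iff.1 hk with rfl | hkS
        · refine ihx (a' k) (hax ▸ hr) a' rfl fun j hj => ?_
          rw [hne j (fun h => hi (h ▸ hj))]
          exact ha j hj
        · refine iha a' ⟨k, hkS, hr, hne⟩ ?_ ?_
          · rw [hne i (fun h => hi (h ▸ hkS)), hax]
          · intro j hj
            by_cases hjk : j = k
            · subst hjk
              exact (ha j hj).inv hr
            · rw [hne j hjk]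
              exact ha j hj

-- Terms, substitutions and the translations `label`, `xi`, `zeta`

namespace Term

variable {S : Signature.{u, w}} {V : Type v}

theorem subst_congr {σ τ : V → Term S V} (p : Term S V) (h : ∀ y ∈ p.vars, σ y = τ y) :
    p.subst σ = p.subst τ := by
  induction p with
  | var x => exact h x rfl
  | app f ts ih =>
    simp only [subst]
    congr 1
    funext i
    exact ih i fun y hy => h y (Set.mem_iUnion.2 ⟨i, hy⟩)

theorem vars_finite (hS : S.Finitary) (p : Term S V) : p.vars.Finite := by
  induction p with
  | var x => exact Set.finite_singleton x
  | app f ts ih =>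
    have := hS f
    exact Set.finite_iUnion ih

end Term

variable {F : Signature.{u, w}} {V : Type v} {R : CTRS F V}

theorem htop_ne_hbot : htop R ≠ hbot R := by
  intro h
  simp only [htop, hbot, Term.app.injEq] at h
  exact absurd h.1 (by simp)

theorem vars_label (p : Term F V) : (label R p).vars = p.vars := by
  induction p with
  | var x => rfl
  | app f ts ih => simp only [label, Term.vars, ih]

theorem vars_xi (p : Term F V) : (xi R (htop R) p).vars = p.vars := by
  induction p with
  | var x => rfl
  | app f ts ih =>
    ext y
    simp only [xi, hfn, Term.vars, Set.mem_iUnion]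
    constructor
    · rintro ⟨i | ρ, h⟩
      · exact ⟨i, by rw [← ih]; exact h⟩
      · simp only [Sum.elim_inr, htop, Term.vars, Set.mem_iUnion] at h
        exact h.choose.elim
    · rintro ⟨i, h⟩
      exact ⟨Sum.inl i, by rw [Sum.elim_inl, ih]; exact h⟩

theorem htop_subst (σ : V → HTerm R) : (htop R).subst σ = htop R := by
  simp only [htop, Term.subst]
  congr 1
  funext i
  exact i.elim

theorem hbot_subst (σ : V → HTerm R) : (hbot R).subst σ = hbot R := by
  simp only [hbot, Term.subst]
  congr 1
  funext i
  exact i.elim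

theorem hfn_subst (f : F.Sym) (ts : F.Pos f → HTerm R) (es : R f → HTerm R) (σ : V → HTerm R) :
    (hfn R f ts es).subst σ = hfn R f (fun i => (ts i).subst σ) (fun ρ => (es ρ).subst σ) := by
  simp only [hfn, Term.subst]
  congr 1
  funext i
  rcases i with i | ρ <;> rfl

theorem xi_app_subst (f : F.Sym) (ts : F.Pos f → Term F V) (σ : V → HTerm R) :
    (xi R (htop R) (.app f ts)).subst σ =
      hfn R f (fun i => (xi R (htop R) (ts i)).subst σ) (fun _ => htop R) := by
  simp only [xi, hfn_subst, htop_subst]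

theorem label_subst_congr {σ τ : V → LTerm R} {p : Term F V} (h : ∀ y ∈ p.vars, σ y = τ y) :
    (label R p).subst σ = (label R p).subst τ :=
  Term.subst_congr _ fun y hy => h y (by rwa [vars_label] at hy)

theorem xi_subst_congr {σ τ : V → HTerm R} {p : Term F V} (h : ∀ y ∈ p.vars, σ y = τ y) :
    (xi R (htop R) p).subst σ = (xi R (htop R) p).subst τ :=
  Term.subst_congr _ fun y hy => h y (by rwa [vars_xi] at hy)

theorem hfn_inj_left {f : F.Sym} {ts ts' : F.Pos f → HTerm R} {es es' : R f → HTerm R}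
    (h : hfn R f ts es = hfn R f ts' es') : ts = ts' := by
  simp only [hfn, Term.app.injEq, heq_eq_eq, true_and] at h
  funext i
  exact congrFun h (Sum.inl i)

/-- Used to see that a substitution stored in `Sim` and the one applied by a rule agree on all
variables bound so far. -/
theorem eq_of_xi_subst_eq {σ τ : V → HTerm R} {p : Term F V}
    (h : (xi R (htop R) p).subst σ = (xi R (htop R) p).subst τ) : ∀ y ∈ p.vars, σ y = τ y := by
  induction p with
  | var x => rintro y rfl; exact h
  | app f ts ih =>
    intro y hy
    obtain ⟨i, hi⟩ := Set.mem_iUnion.1 hy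
    rw [xi_app_subst, xi_app_subst] at h
    exact ih i (congrFun (hfn_inj_left h) i) y hi

theorem zeta_label_subst (p : Term F V) (σ : V → LTerm R) :
    zeta R ((label R p).subst σ) = (xi R (htop R) p).subst (fun y => zeta R (σ y)) := by
  induction p with
  | var x => rfl
  | app f ts ih =>
    rw [xi_app_subst]
    simp only [label, Term.subst, zeta, ih, Set.mem_univ, if_true]

/-! ### Closure properties of labeled reductions -/

/-- Only the replacement in the last premise of each kind of step mentions the surrounding term. -/
theorem LStep.arg {g : (LSig R).Sym} {ss ss' : (LSig R).Pos g → LTerm R} {i : (LSig R).Pos g}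
    {n : ℕ} (h : LStep R (ss i) (ss' i) n) (hne : ∀ j, j ≠ i → ss' j = ss j) :
    LStep R (.app g ss) (.app g ss') n := by
  have lift : ∀ u u' : LTerm R, Term.ReplaceAny u u' (ss i) (ss' i) →
      Term.ReplaceAny u u' (.app g ss) (.app g ss') :=
    fun u u' hr => Term.Replace.arg g ss ss' i (Set.mem_univ _) hr hne
  generalize ha : ss i = a at h
  generalize hb : ss' i = b at h
  rw [ha, hb] at lift
  cases h with
  | bot _ _ f L ρ us σ h1 h2 h3 h4 h5 h6 => exact .bot _ _ f L ρ us σ h1 h2 h3 h4 h5 (lift _ _ h6)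
  | success _ _ f L ρ σ c h1 h2 h3 => exact .success _ _ f L ρ σ c h1 h2 (lift _ _ h3)
  | fail _ _ f L ρ σ j c d u τ h1 h2 h3 h4 h5 h6 h7 h8 =>
    exact .fail _ _ f L ρ σ j c d u τ h1 h2 h3 h4 h5 h6 h7 (lift _ _ h8)

/-- Induction along the sequence of steps only; reductions nested in the premises of the steps are
left opaque. -/
theorem LRed.induct {P : LTerm R → LTerm R → ℕ → Prop} (refl : ∀ s, P s s 0)
    (head : ∀ s t u m n, LStep R s t m → P t u n → P s u (m + n)) :
    ∀ {s t n}, LRed R s t n → P s t n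
  | _, _, _, .refl s => refl s
  | _, _, _, .head s t u m n h1 h2 => head s t u m n h1 (LRed.induct refl head h2)

theorem LRed.trans {s t u : LTerm R} {m n : ℕ} (h : LRed R s t m) :
    LRed R t u n → LRed R s u (m + n) :=
  LRed.induct (P := fun s t m => LRed R t u n → LRed R s u (m + n))
    (fun s h => by simpa using h)
    (fun s t _ m m' h1 ih h => by rw [add_assoc]; exact .head _ _ _ _ _ h1 (ih h)) h

theorem LRed.single {s t : LTerm R} {n : ℕ} (h : LStep R s t n) : LRed R s t n :=
  .head _ _ _ _ _ h (.refl _)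

/-- One complexity-conscious step of any cost. -/
def LRel (R : CTRS F V) (s t : LTerm R) : Prop := ∃ n, LStep R s t n

theorem LRed.reflTransGen {s t : LTerm R} {n : ℕ} (h : LRed R s t n) :
    Relation.ReflTransGen (LRel R) s t :=
  LRed.induct (P := fun s t _ => Relation.ReflTransGen (LRel R) s t)
    (fun _ => .refl) (fun _ _ _ _ _ h1 ih => .head ⟨_, h1⟩ ih) h

open scoped Classical in
theorem LRed.update {g : (LSig R).Sym} (ss : (LSig R).Pos g → LTerm R) {i : (LSig R).Pos g}
    {s t : LTerm R} {n : ℕ} (h : LRed R s t n) :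
    LRed R (.app g (Function.update ss i s)) (.app g (Function.update ss i t)) n := by
  refine LRed.induct (P := fun s t n =>
      LRed R (.app g (Function.update ss i s)) (.app g (Function.update ss i t)) n)
    (fun s => .refl _) (fun s t u m m' h1 ih => ?_) h
  refine .head _ _ _ _ _ (LStep.arg (i := i) ?_ fun j hj => ?_) ih
  · simpa using h1
  · simp [hj]

theorem LRed.app [∀ f, Fintype (F.Pos f)] {f : F.Sym} {L : Set (R f)} {ss ss' : F.Pos f → LTerm R}
    {n : F.Pos f → ℕ} (h : ∀ i, LRed R (ss i) (ss' i) (n i)) :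
    LRed R (lapp R f L ss) (lapp R f L ss') (∑ i, n i) := by
  classical
  -- The arguments are reduced one at a time; `A` collects those already finished.
  suffices H : ∀ A : Finset (F.Pos f), LRed R (lapp R f L ss)
      (lapp R f L fun i => if i ∈ A then ss' i else ss i) (∑ i ∈ A, n i) by
    simpa using H Finset.univ
  intro A
  induction A using Finset.induction_on with
  | empty => simpa using LRed.refl _
  | insert i A hi ih =>
    rw [Finset.sum_insert hi, add_comm]
    refine ih.trans ?_
    have := LRed.update (g := (⟨f, L⟩ : (LSig R).Sym)) (i := i)
      (fun j => if j ∈ A then ss' j else ss j) (h i)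
    convert this using 2
    · symm
      rw [Function.update_eq_self_iff]
      simp [hi]
    · funext j
      by_cases hj : j = i
      · subst hj; simp
      · simp [hj]

end CondRew

namespace CondRew

noncomputable section Simulation

open scoped Classical

variable {F : Signature.{u, w}} {V : Type v} {R : CTRS F V} [∀ f, Fintype (F.Pos f)]

theorem sum_biUnion_le {ι : Type*} (S : Finset ι) (t : ι → Finset V) (m : V → ℕ) :
    ∑ y ∈ S.biUnion t, m y ≤ ∑ i ∈ S, ∑ y ∈ t i, m y := by
  induction S using Finset.induction_on with
  | empty => simp
  | insert i S hi ih =>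
    rw [Finset.biUnion_insert, Finset.sum_insert hi]
    have := Finset.sum_union_inter (s₁ := t i) (s₂ := S.biUnion t) (f := m)
    omega

/-! ### The simulation relation -/

/-- The finite set of variables of a term. -/
def fvars : Term F V → Finset V
  | .var x => {x}
  | .app _ ts => Finset.univ.biUnion fun i => fvars (ts i)

theorem mem_fvars {y : V} {p : Term F V} : y ∈ fvars p ↔ y ∈ p.vars := by
  induction p with
  | var x => simp [fvars, Term.vars]
  | app f ts ih => simp [fvars, Term.vars, ih]

/-- The variables bound by the left-hand side of `ρ` and its first `n` conditions. -/
def bound {f : F.Sym} (ρ : Rule F V f) (n : ℕ) : Finset V :=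
  fvars ρ.lhs ∪ (Finset.univ.filter fun l : Fin ρ.k => l.val < n).biUnion fun l => fvars (ρ.b l)

/-- The variables used in the left-hand sides of the first `n` conditions of `ρ`. -/
def used {f : F.Sym} (ρ : Rule F V f) (n : ℕ) : Finset V :=
  (Finset.univ.filter fun l : Fin ρ.k => l.val < n).biUnion fun l => fvars (ρ.a l)

theorem mem_bound {f : F.Sym} {ρ : Rule F V f} {n : ℕ} {y : V} :
    y ∈ bound ρ n ↔ y ∈ ρ.lhs.vars ∨ ∃ l : Fin ρ.k, l.val < n ∧ y ∈ (ρ.b l).vars := by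
  simp [bound, mem_fvars]

theorem mem_used {f : F.Sym} {ρ : Rule F V f} {n : ℕ} {y : V} :
    y ∈ used ρ n ↔ ∃ l : Fin ρ.k, l.val < n ∧ y ∈ (ρ.a l).vars := by
  simp [used, mem_fvars]

/-- Some labeled reduction from `s` has cost at least `d`. -/
def Reaches (R : CTRS F V) (s : LTerm R) (d : ℕ) : Prop := ∃ t M, LRed R s t M ∧ d ≤ M

/-- `Sim R s t D`: the term `t` represents the labeled term `s`, where the evaluation of some
conditions may be in progress. The number `D` is a bound on the cost spent in `t` on these
unfinished evaluations, which has not been accounted for in `s`. -/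
inductive Sim (R : CTRS F V) : LTerm R → HTerm R → ℕ → Prop
  | fn (f : F.Sym) (L : Set (R f)) (ss : F.Pos f → LTerm R) (a : HPos R (.fn f) → HTerm R)
      (d : F.Pos f → ℕ) (D : ℕ) :
      (∀ i, Sim R (ss i) (a (.inl i)) (d i)) →
      (∀ ρ, a (.inr ρ) = if ρ ∈ L then htop R else hbot R) →
      D ≤ ∑ i, d i →
      Sim R (lapp R f L ss) (Term.app (S := HSig R) (.fn f) a) D
  -- The labeled side is still the redex. The completed conditions `l < j` are stored as finished
  -- reductions, and condition `j` as a partial one to `u`, which represents the active argument.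
  -- Inactive arguments cannot change, so they remain instances by `σ'`; payability of their debts
  -- must be stored because they can no longer be rewritten.
  | cond (f : F.Sym) (L : Set (R f)) (ρ : R f) (j : Fin ρ.1.k) (σ : V → LTerm R)
      (σ' : V → HTerm R) (δ : V → ℕ) (c : Fin ρ.1.k → ℕ) (u : LTerm R) (e : ℕ)
      (a : HPos R (.cond f ρ j) → HTerm R) (D : ℕ) :
      ρ ∈ L →
      (∀ y ∈ bound ρ.1 j, Sim R (σ y) (σ' y) (δ y)) →
      (∀ y ∈ bound ρ.1 j, Reaches R (σ y) (δ y)) →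
      (∀ l, l < j → LRed R ((label R (ρ.1.a l)).subst σ) ((label R (ρ.1.b l)).subst σ) (c l)) →
      LRed R ((label R (ρ.1.a j)).subst σ) u (c j) →
      Sim R u (a (.inr (.inr ⟨j, le_rfl⟩))) e →
      (∀ i, a (.inl i) = (xi R (htop R) (ρ.1.args i)).subst σ') →
      (∀ ρ', a (.inr (.inl ρ')) = if ρ'.1 ∈ L then htop R else hbot R) →
      (∀ l, l.1 < j → a (.inr (.inr l)) = (xi R (htop R) (ρ.1.b l.1)).subst σ') →
      -- A variable used in one of the conditions up to `j` has handed its debt over to the costs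
      -- `c` or to `e`, so only unused bound variables contribute their own debt.
      D ≤ ∑ y ∈ bound ρ.1 j \ used ρ.1 (j + 1), δ y + ∑ l ∈ Finset.Iic j, c l + e →
      Sim R (lapp R f L fun i => (label R (ρ.1.args i)).subst σ)
        (Term.app (S := HSig R) (.cond f ρ j) a) D

theorem Sim.mono {s : LTerm R} {t : HTerm R} {D D' : ℕ} (h : Sim R s t D) (hD : D' ≤ D) :
    Sim R s t D' := by
  cases h with
  | fn f L ss a d _ h1 h2 h3 => exact .fn f L ss a d _ h1 h2 (hD.trans h3)
  | cond f L ρ j σ σ' δ c u e a _ h1 h2 h3 h4 h5 h6 h7 h8 h9 h10 =>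
    exact .cond f L ρ j σ σ' δ c u e a _ h1 h2 h3 h4 h5 h6 h7 h8 h9 (hD.trans h10)

theorem Sim.of_fn {s : LTerm R} {f : F.Sym} {a : HPos R (.fn f) → HTerm R} {D : ℕ}
    (h : Sim R s (Term.app (S := HSig R) (.fn f) a) D) :
    ∃ (L : Set (R f)) (ss : F.Pos f → LTerm R) (d : F.Pos f → ℕ), s = lapp R f L ss ∧
      (∀ i, Sim R (ss i) (a (.inl i)) (d i)) ∧
      (∀ ρ, a (.inr ρ) = if ρ ∈ L then htop R else hbot R) ∧ D ≤ ∑ i, d i := by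
  cases h with
  | fn f L ss a d _ h1 h2 h3 => exact ⟨L, ss, d, rfl, h1, h2, h3⟩

theorem Sim.of_hfn {s : LTerm R} {f : F.Sym} {ts : F.Pos f → HTerm R} {es : R f → HTerm R} {D : ℕ}
    (h : Sim R s (hfn R f ts es) D) :
    ∃ (L : Set (R f)) (ss : F.Pos f → LTerm R) (d : F.Pos f → ℕ), s = lapp R f L ss ∧
      (∀ i, Sim R (ss i) (ts i) (d i)) ∧
      (∀ ρ, es ρ = if ρ ∈ L then htop R else hbot R) ∧ D ≤ ∑ i, d i :=
  Sim.of_fn h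

theorem Sim.mk_hfn {f : F.Sym} {L : Set (R f)} {ss : F.Pos f → LTerm R} {ts : F.Pos f → HTerm R}
    {es : R f → HTerm R} {d : F.Pos f → ℕ} (h : ∀ i, Sim R (ss i) (ts i) (d i))
    (he : ∀ ρ, es ρ = if ρ ∈ L then htop R else hbot R) :
    Sim R (lapp R f L ss) (hfn R f ts es) (∑ i, d i) :=
  .fn f L ss _ d _ h he le_rfl

/-- An unfinished condition belongs to a rule in the label, so an empty label excludes it at the
root. -/
theorem Sim.of_empty {f : F.Sym} {us : F.Pos f → LTerm R} {t : HTerm R} {D : ℕ}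
    (h : Sim R (lapp R f ∅ us) t D) :
    ∃ (ts : F.Pos f → HTerm R) (es : R f → HTerm R) (d : F.Pos f → ℕ), t = hfn R f ts es ∧
      (∀ i, Sim R (us i) (ts i) (d i)) ∧ D ≤ ∑ i, d i := by
  generalize hs : lapp R f ∅ us = s at h
  cases h with
  | fn f' L ss a d _ h1 h2 h3 =>
    simp only [lapp, Term.app.injEq] at hs
    obtain ⟨h, hs⟩ := hs
    cases h
    cases hs
    refine ⟨fun i => a (.inl i), fun ρ => a (.inr ρ), d, ?_, h1, h3⟩
    simp only [hfn]
    congr 1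
    funext i
    rcases i with i | ρ <;> rfl
  | cond f' L ρ j σ σ' δ c u e a _ h1 =>
    simp only [lapp, Term.app.injEq] at hs
    obtain ⟨h, hs⟩ := hs
    cases h
    exact absurd h1 (Set.notMem_empty _)

/-- A ground labeled term is represented by its translation. -/
theorem Sim.of_ground {s : LTerm R} (hs : s.Ground) : Sim R s (zeta R s) 0 := by
  induction s with
  | var x => exact absurd hs (Set.singleton_ne_empty x)
  | app g ss ih =>
    have h : ∀ i, Sim R (ss i) (zeta R (ss i)) 0 := fun i =>
      ih i (Set.subset_empty_iff.1 (hs ▸ Set.subset_iUnion (fun i => (ss i).vars) i))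
    exact (Sim.mk_hfn (f := g.1) (L := g.2) h fun ρ => rfl).mono (Nat.zero_le _)

/-- `p` need not be linear: each occurrence of a variable carries its debt, while the stated debt
counts it once. -/
theorem Sim.pattern {σ : V → LTerm R} {σ' : V → HTerm R} {δ : V → ℕ} (p : Term F V)
    (h : ∀ y ∈ p.vars, Sim R (σ y) (σ' y) (δ y)) :
    Sim R ((label R p).subst σ) ((xi R (htop R) p).subst σ') (∑ y ∈ fvars p, δ y) := by
  induction p with
  | var x =>
    rw [fvars, Finset.sum_singleton]
    exact h x rfl
  | app f ts ih =>
    rw [xi_app_subst]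
    refine (Sim.mk_hfn (L := Set.univ)
      (fun i => ih i fun y hy => h y (Set.mem_iUnion.2 ⟨i, hy⟩)) (by simp)).mono ?_
    exact sum_biUnion_le ..

/-- `s` is the instance by `σ` of the pattern `p`, and the debt `d` of `s` is due to the debts `δ`
of the substituted terms, which are represented by `σ'`. -/
structure Matches (R : CTRS F V) (p : Term F V) (s : LTerm R) (σ' : V → HTerm R) (d : ℕ)
    (σ : V → LTerm R) (δ : V → ℕ) : Prop where
  eq : s = (label R p).subst σ
  sim : ∀ y ∈ p.vars, Sim R (σ y) (σ' y) (δ y)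
  le : d ≤ ∑ y ∈ fvars p, δ y

theorem Matches.congr {p : Term F V} {s : LTerm R} {σ' : V → HTerm R} {d : ℕ}
    {σ τ : V → LTerm R} {δ ε : V → ℕ} (h : Matches R p s σ' d σ δ)
    (hσ : ∀ y ∈ p.vars, τ y = σ y) (hδ : ∀ y ∈ p.vars, ε y = δ y) :
    Matches R p s σ' d τ ε where
  eq := h.eq.trans (label_subst_congr fun y hy => (hσ y hy).symm)
  sim y hy := by rw [hσ y hy, hδ y hy]; exact h.sim y hy
  le := h.le.trans (Finset.sum_congr rfl fun y hy => (hδ y (mem_fvars.1 hy)).symm).le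

theorem exists_matches_family {ι : Type*} {p : ι → Term F V} {s : ι → LTerm R} {σ' : V → HTerm R}
    {d : ι → ℕ} (hp : ∀ i j, i ≠ j → Disjoint (p i).vars (p j).vars)
    (h : ∀ i, ∃ σ δ, Matches R (p i) (s i) σ' (d i) σ δ) :
    ∃ σ δ, ∀ i, Matches R (p i) (s i) σ' (d i) σ δ := by
  choose σ δ h using h
  obtain ⟨τ, hτ⟩ := exists_glue (fun i => (p i).vars) (fun i y => (σ i y, δ i y)) hp
    (fun y => (.var y, 0))
  exact ⟨fun y => (τ y).1, fun y => (τ y).2, fun i =>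
    (h i).congr (fun y hy => by rw [hτ i y hy]) (fun y hy => by rw [hτ i y hy])⟩

/-- A representing term with a symbol `fn f` at its root determines the root of the labeled term,
and a constructor admits only one label. So the labeled term has the shape of `p`, and linearity
lets the substitutions found in the arguments be glued and the debts be summed without loss. -/
theorem Sim.exists_matches {σ' : V → HTerm R} {p : Term F V} (hc : ConstructorTerm R p)
    (hl : p.Linear) {s : LTerm R} {d : ℕ} (h : Sim R s ((xi R (htop R) p).subst σ') d) :
    ∃ σ δ, Matches R p s σ' d σ δ := by
  induction p generalizing s d with
  | var x =>
    exact ⟨fun _ => s, fun _ => d, rfl, fun y hy => by cases hy; exact h, by simp [fvars]⟩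
  | app f ts ih =>
    rw [xi_app_subst] at h
    obtain ⟨L, ss, e, rfl, h1, -, h3⟩ := h.of_hfn
    obtain ⟨σ, δ, hm⟩ := exists_matches_family hl.2 fun i => ih i (hc.2 i) (hl.1 i) (h1 i)
    have hL : L = Set.univ := by
      ext ρ
      exact absurd ⟨_, ρ.2⟩ hc.1
    refine ⟨σ, δ, ?_, ?_, ?_⟩
    · subst hL
      simp only [label, Term.subst]
      congr 1
      funext i
      exact (hm i).eq
    · intro y hy
      obtain ⟨i, hi⟩ := Set.mem_iUnion.1 hy
      exact (hm i).sim y hi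
    · refine h3.trans ((Finset.sum_le_sum fun i _ => (hm i).le).trans (le_of_eq ?_))
      simp only [fvars]
      rw [Finset.sum_biUnion]
      intro i _ j _ hij
      rw [Function.onFun, Finset.disjoint_left]
      intro y hy hy'
      exact Set.disjoint_left.1 (hl.2 i j hij) (mem_fvars.1 hy) (mem_fvars.1 hy')

/-! ### Discharging debts -/

/-- `u` is an argument of `t` at an active position. -/
inductive ActiveArg (R : CTRS F V) : HTerm R → HTerm R → Prop
  | mk (g : HSym R) (a : HPos R g → HTerm R) (i : HPos R g) : i ∈ mu R g →
      ActiveArg R (a i) (Term.app (S := HSig R) g a)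

/-- `u` is a proper subterm of `t` at an active position. -/
def ActiveSub (R : CTRS F V) : HTerm R → HTerm R → Prop := Relation.TransGen (ActiveArg R)

/-- The debt of every labeled term represented by `t` can be paid. -/
def Dischargeable (R : CTRS F V) (t : HTerm R) : Prop := ∀ s d, Sim R s t d → Reaches R s d

/-- All proper subterms of `t` at active positions are dischargeable. -/
def SubDischargeable (R : CTRS F V) (t : HTerm R) : Prop :=
  ∀ u, ActiveSub R u t → Dischargeable R u

omit [∀ f, Fintype (F.Pos f)] in
theorem activeArg_hfn {f : F.Sym} (ts : F.Pos f → HTerm R) (es : R f → HTerm R) (i : F.Pos f) :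
    ActiveArg R (ts i) (hfn R f ts es) :=
  ActiveArg.mk (.fn f) (Sum.elim ts es) (.inl i) ⟨i, rfl⟩

omit [∀ f, Fintype (F.Pos f)] in
theorem activeSub_pattern {σ' : V → HTerm R} {p : Term F V} {y : V} (hy : y ∈ p.vars) :
    Relation.ReflTransGen (ActiveArg R) (σ' y) ((xi R (htop R) p).subst σ') := by
  induction p with
  | var x => cases hy; exact .refl
  | app f ts ih =>
    obtain ⟨i, hi⟩ := Set.mem_iUnion.1 hy
    rw [xi_app_subst]
    exact (ih i hi).tail
      (activeArg_hfn (fun i => (xi R (htop R) (ts i)).subst σ') (fun _ => htop R) i)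

theorem SubDischargeable.arg {t u : HTerm R} (h : SubDischargeable R t) (hu : ActiveArg R u t) :
    SubDischargeable R u :=
  fun v hv => h v (hv.tail hu)

-- Applied to a set `Y` of variables whose debts the next labeled step would lose; all other values
-- stay fixed, so that stored reductions involving only them remain usable.
omit [∀ f, Fintype (F.Pos f)] in
theorem exists_discharged_subst {σ : V → LTerm R} {δ : V → ℕ} (Y : Finset V)
    (h : ∀ y ∈ Y, Reaches R (σ y) (δ y)) :
    ∃ (τ : V → LTerm R) (m : V → ℕ), (∀ y, LRed R (σ y) (τ y) (m y)) ∧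
      (∀ y ∉ Y, τ y = σ y) ∧ ∀ y ∈ Y, δ y ≤ m y := by
  have : ∀ y, ∃ t M, LRed R (σ y) t M ∧ (y ∉ Y → t = σ y) ∧ (y ∈ Y → δ y ≤ M) := by
    intro y
    by_cases hy : y ∈ Y
    · obtain ⟨t, M, h1, h2⟩ := h y hy
      exact ⟨t, M, h1, fun h => absurd hy h, fun _ => h2⟩
    · exact ⟨σ y, 0, .refl _, fun _ => rfl, fun h => absurd h hy⟩
  choose τ m h1 h2 h3 using this
  exact ⟨τ, m, h1, h2, h3⟩

theorem LRed.pattern {σ τ : V → LTerm R} {m : V → ℕ} (h : ∀ y, LRed R (σ y) (τ y) (m y))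
    (p : Term F V) :
    ∃ M, LRed R ((label R p).subst σ) ((label R p).subst τ) M ∧ ∑ y ∈ fvars p, m y ≤ M := by
  induction p with
  | var x => exact ⟨m x, h x, by simp [fvars]⟩
  | app f ts ih =>
    choose M h1 h2 using ih
    exact ⟨∑ i, M i, LRed.app h1,
      (sum_biUnion_le ..).trans (Finset.sum_le_sum fun i _ => h2 i)⟩

/-! ### Labeled terms that do not match a pattern -/

/-- The symbols of `s` clash with those of the pattern `p` at some position of `s` above which,
and at which, all labels are empty. -/
inductive NoMatch (R : CTRS F V) : Term F V → LTerm R → Prop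
  | root (f : F.Sym) (ts : F.Pos f → Term F V) (g : F.Sym) (us : F.Pos g → LTerm R) :
      g ≠ f → NoMatch R (.app f ts) (lapp R g ∅ us)
  | arg (f : F.Sym) (ts : F.Pos f → Term F V) (us : F.Pos f → LTerm R) (i : F.Pos f) :
      NoMatch R (ts i) (us i) → NoMatch R (.app f ts) (lapp R f ∅ us)

omit [∀ f, Fintype (F.Pos f)] in
theorem label_eq_empty {f : F.Sym} {L : Set (R f)}
    (h : ∀ ρ, hbot R = if ρ ∈ L then htop R else hbot R) : L = ∅ := by
  ext ρ
  refine ⟨fun hρ => ?_, fun h => absurd h (Set.notMem_empty _)⟩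
  have := h ρ
  rw [if_pos hρ] at this
  exact absurd this.symm htop_ne_hbot

/-- The additional arguments `⊥` of an anti-pattern force the label to be empty at each symbol on
the path to the clash. -/
theorem AP.noMatch {p : Term F V} {v : HTerm R} (h : AP R p v) {σ' : V → HTerm R} {s : LTerm R}
    {D : ℕ} (hs : Sim R s (v.subst σ') D) : NoMatch R p s := by
  induction h generalizing s D with
  | other f ts g x hg hx =>
    simp only [hfn_subst, hbot_subst] at hs
    obtain ⟨L, ss, d, rfl, -, h2, -⟩ := hs.of_hfn
    obtain rfl := label_eq_empty h2
    exact .root _ _ _ _ hg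
  | arg f ts i u x hu hx hxu ih =>
    simp only [hfn_subst, hbot_subst] at hs
    obtain ⟨L, ss, d, rfl, h1, h2, -⟩ := hs.of_hfn
    obtain rfl := label_eq_empty h2
    have := h1 i
    simp only [Function.update_self] at this
    exact .arg _ _ _ i (ih this)

/-- The labels on the path to the clash are empty, so no condition is in progress there. All debts
lie in proper active subterms, and paying them leaves the path and the clash intact. -/
theorem NoMatch.discharge {p : Term F V} {s : LTerm R} (h : NoMatch R p s) {t : HTerm R} {D : ℕ}
    (hs : Sim R s t D) (ht : SubDischargeable R t) :
    ∃ s' M, LRed R s s' M ∧ D ≤ M ∧ NoMatch R p s' := by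
  induction h generalizing t D with
  | root f ts g us hg =>
    obtain ⟨vs, es, d, rfl, h1, h2⟩ := hs.of_empty
    choose s' M h3 h4 using fun i => ht _ (.single (activeArg_hfn vs es i)) _ _ (h1 i)
    exact ⟨_, _, LRed.app h3, h2.trans (Finset.sum_le_sum fun i _ => h4 i), .root _ _ _ _ hg⟩
  | arg f ts us i hi ih =>
    obtain ⟨vs, es, d, rfl, h1, h2⟩ := hs.of_empty
    have : ∀ j, ∃ s' M, LRed R (us j) s' M ∧ d j ≤ M ∧ (j = i → NoMatch R (ts i) s') := by
      intro j
      by_cases hj : j = i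
      · subst hj
        obtain ⟨s', M, h3, h4, h5⟩ := ih (h1 j) (ht.arg (activeArg_hfn vs es j))
        exact ⟨s', M, h3, h4, fun _ => h5⟩
      · obtain ⟨s', M, h3, h4⟩ := ht _ (.single (activeArg_hfn vs es j)) _ _ (h1 j)
        exact ⟨s', M, h3, h4, fun h => absurd h hj⟩
    choose s' M h3 h4 h5 using this
    exact ⟨_, _, LRed.app h3, h2.trans (Finset.sum_le_sum fun i _ => h4 i),
      .arg _ _ _ i (h5 i rfl)⟩

end Simulation

end CondRew

-- Failure witnesses and steps at the root

namespace CondRew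

noncomputable section RootSteps

open scoped Classical

variable {F : Signature.{u, w}} {V : Type v} {R : CTRS F V} [∀ f, Fintype (F.Pos f)]

/-- A term is an instance of a linear term that agrees with a given pattern of one argument and
has fresh variables as its other arguments. -/
theorem Term.exists_linear_args {S : Signature.{u, w}} {V : Type v} [Infinite V] (g : S.Sym)
    [Finite (S.Pos g)] (ts : S.Pos g → Term S V) (i : S.Pos g) (p : Term S V)
    (τ : V → Term S V) (hp : p.subst τ = ts i) (hl : p.Linear) (hfin : p.vars.Finite)
    (A : Set V) (hA : A.Finite) (hd : Disjoint p.vars A) :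
    ∃ (us : S.Pos g → Term S V) (σ : V → Term S V), us i = p ∧
      (∀ j, j ≠ i → ∃ y, us j = .var y) ∧ (∀ j, (us j).subst σ = ts j) ∧
      (Term.app g us).Linear ∧ Disjoint (Term.app g us).vars A := by
  obtain ⟨x, hx, hxA⟩ := exists_fresh_family (S.Pos g) (p.vars ∪ A) (hfin.union hA)
  have hv : ∀ j, j ≠ i → Function.update (fun j => Term.var (S := S) (x j)) i p j = .var (x j) :=
    fun j hj => Function.update_of_ne hj _ _
  refine ⟨Function.update (fun j => .var (x j)) i p, Function.extend x ts τ,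
    Function.update_self .., fun j hj => ⟨x j, hv j hj⟩, ?_, ⟨?_, ?_⟩, ?_⟩
  · intro j
    by_cases hj : j = i
    · subst hj
      rw [Function.update_self, ← hp]
      refine Term.subst_congr _ fun y hy => Function.extend_apply' _ _ _ ?_
      rintro ⟨k, rfl⟩
      exact hxA k (Or.inl hy)
    · rw [hv j hj]
      exact hx.extend_apply _ _ j
  · intro j
    by_cases hj : j = i
    · subst hj
      rwa [Function.update_self]
    · rw [hv j hj]
      trivial
  · intro j k hjk
    by_cases hj : j = i
    · subst hj
      rw [Function.update_self, hv k hjk.symm]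
      exact Set.disjoint_singleton_right.2 fun h => hxA k (Or.inl h)
    · rw [hv j hj]
      by_cases hk : k = i
      · subst hk
        rw [Function.update_self]
        exact Set.disjoint_singleton_left.2 fun h => hxA j (Or.inl h)
      · rw [hv k hk]
        exact Set.disjoint_singleton.2 fun h => hjk (hx h)
  · refine Set.disjoint_iUnion_left.2 fun j => ?_
    by_cases hj : j = i
    · subst hj
      rwa [Function.update_self]
    · rw [hv j hj]
      exact Set.disjoint_singleton_left.2 fun h => hxA j (Or.inr h)

theorem lsig_finitary : (LSig R).Finitary := fun g => inferInstanceAs (Finite (F.Pos g.1))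

/-- Keep the symbols on the path to the clash and generalize everything beside it to distinct fresh
variables. This supplies the linear labeled normal form demanded by matching failures and failed
steps. -/
theorem NoMatch.exists_pattern [Infinite V] {p : Term F V} {s : LTerm R} (h : NoMatch R p s)
    (A : Set V) (hA : A.Finite) :
    ∃ (u : LTerm R) (τ : V → LTerm R), u.subst τ = s ∧ LabeledNF R u ∧ u.Linear ∧
      Disjoint u.vars A ∧ ¬ Term.Unifiable u (label R p) := by
  induction h with
  | root f ts g us hg =>
    obtain ⟨x, hx, hxA⟩ := exists_fresh_family (F.Pos g) A hA
    refine ⟨lapp R g ∅ fun j => .var (x j), Function.extend x us (fun y => .var y), ?_, ?_, ?_, ?_,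
      ?_⟩
    · simp only [Term.subst]
      congr 1
      funext j
      exact hx.extend_apply _ _ j
    · exact ⟨rfl, fun j => trivial⟩
    · exact ⟨fun j => trivial, fun j k hjk => Set.disjoint_singleton.2 fun h => hjk (hx h)⟩
    · exact Set.disjoint_iUnion_left.2 fun j => Set.disjoint_singleton_left.2 (hxA j)
    · rintro ⟨θ, hθ⟩
      simp only [label, Term.subst, Term.app.injEq] at hθ
      exact hg (congrArg Sigma.fst hθ.1)
  | arg f ts us i hi ih =>
    obtain ⟨p, τ, h1, h2, h3, h4, h5⟩ := ih
    have : Finite ((LSig R).Pos ⟨f, ∅⟩) := lsig_finitary _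
    obtain ⟨vs, σ, h6, h7, h8, h9, h10⟩ := Term.exists_linear_args
      (S := LSig R) ⟨f, ∅⟩ us i p τ h1 h3 (Term.vars_finite lsig_finitary p) A hA h4
    refine ⟨lapp R f ∅ vs, σ, ?_, ⟨rfl, fun j => ?_⟩, h9, h10, ?_⟩
    · simp only [Term.subst, h8]
    · by_cases hj : j = i
      · subst hj
        rw [h6]
        exact h2
      · obtain ⟨y, hy⟩ := h7 j hj
        rw [hy]
        trivial
    · rintro ⟨θ, hθ⟩
      simp only [label, Term.subst, Term.app.injEq] at hθ
      refine h5 ⟨θ, ?_⟩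
      rw [← h6]
      exact congrFun (eq_of_heq hθ.2) i

theorem NoMatch.lstep [Infinite V] {f : F.Sym} {L : Set (R f)} {ρ : R f} {ss : F.Pos f → LTerm R}
    {i : F.Pos f} (h : NoMatch R (ρ.1.args i) (ss i)) (hρ : ρ ∈ L) :
    LStep R (lapp R f L ss) (lapp R f (L \ {ρ}) ss) 0 := by
  have hA : ρ.1.lhs.vars.Finite :=
    Term.vars_finite (S := F) (fun f => inferInstanceAs (Finite (F.Pos f))) _
  obtain ⟨p, τ, h1, h2, h3, h4, h5⟩ := h.exists_pattern _ hA
  have : Finite ((LSig R).Pos ⟨f, L⟩) := lsig_finitary _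
  obtain ⟨vs, σ, h6, h7, h8, h9, h10⟩ := Term.exists_linear_args
    (S := LSig R) ⟨f, L⟩ ss i p τ h1 h3 (Term.vars_finite lsig_finitary p) _ hA h4
  refine .bot _ _ f L ρ vs σ hρ (fun j => ?_) h9 h10 ?_ ?_
  · by_cases hj : j = i
    · subst hj
      rw [h6]
      exact h2
    · obtain ⟨y, hy⟩ := h7 j hj
      rw [hy]
      trivial
  · rintro ⟨θ, hθ⟩
    simp only [Term.subst, Term.app.injEq] at hθ
    refine h5 ⟨θ, ?_⟩
    rw [← h6]
    exact congrFun (eq_of_heq hθ.2) i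
  · simp only [Term.subst, h8]
    exact .root

/-! ### Variables of rules -/

section RuleVars

variable (hR : IsStrongCCTRS R) {f : F.Sym} (ρ : R f)
include hR

theorem a_vars_subset_bound (l : Fin ρ.1.k) {y : V} (hy : y ∈ (ρ.1.a l).vars) :
    y ∈ bound ρ.1 l := by
  rcases hR.a_vars f ρ.1 ρ.2 l hy with h | h
  · exact mem_bound.2 (.inl h)
  · simp only [Set.mem_iUnion] at h
    obtain ⟨m, hm, h⟩ := h
    exact mem_bound.2 (.inr ⟨m, hm, h⟩)

theorem b_vars_not_mem_bound (j : Fin ρ.1.k) {y : V} (hy : y ∈ (ρ.1.b j).vars) {n : ℕ}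
    (hn : n ≤ j) : y ∉ bound ρ.1 n := by
  intro h
  rcases mem_bound.1 h with h | ⟨l, hl, h⟩
  · exact Set.disjoint_left.1 (hR.lhs_disjoint f ρ.1 ρ.2 j) h hy
  · refine Set.disjoint_left.1 (hR.b_disjoint f ρ.1 ρ.2 l j ?_) h hy
    rintro rfl
    omega

theorem used_succ_subset_bound (j : Fin ρ.1.k) {y : V} (hy : y ∈ used ρ.1 (j + 1)) :
    y ∈ bound ρ.1 j := by
  obtain ⟨l, hl, h⟩ := mem_used.1 hy
  rcases mem_bound.1 (a_vars_subset_bound hR ρ l h) with h | ⟨m, hm, h⟩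
  · exact mem_bound.2 (.inl h)
  · exact mem_bound.2 (.inr ⟨m, by omega, h⟩)

theorem rhs_vars_subset_bound {y : V} (hy : y ∈ ρ.1.rhs.vars) : y ∈ bound ρ.1 ρ.1.k := by
  rcases hR.rhs_vars f ρ.1 ρ.2 hy with h | h
  · exact mem_bound.2 (.inl h)
  · obtain ⟨l, h⟩ := Set.mem_iUnion.1 h
    exact mem_bound.2 (.inr ⟨l, l.2, h⟩)

end RuleVars

/-! ### Evaluation of conditions -/

/-- The first `n` conditions of the rule `ρ` are satisfied under the substitution `σ`, with costs
`c`. The values of `σ` are represented by those of `σ'`, with payable debts `δ`. -/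
structure Satisfied (R : CTRS F V) {f : F.Sym} (ρ : R f) (n : ℕ) (σ : V → LTerm R)
    (σ' : V → HTerm R) (δ : V → ℕ) (c : Fin ρ.1.k → ℕ) : Prop where
  sim : ∀ y ∈ bound ρ.1 n, Sim R (σ y) (σ' y) (δ y)
  reaches : ∀ y ∈ bound ρ.1 n, Reaches R (σ y) (δ y)
  red : ∀ l, l.val < n →
    LRed R ((label R (ρ.1.a l)).subst σ) ((label R (ρ.1.b l)).subst σ) (c l)

/-- The debt of a redex for which the first `n` conditions of the rule `ρ` are satisfied. -/
def debt {f : F.Sym} (ρ : Rule F V f) (n : ℕ) (δ : V → ℕ) (c : Fin ρ.k → ℕ) : ℕ :=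
  ∑ y ∈ bound ρ n \ used ρ n, δ y + ∑ l with l.val < n, c l

/-- The transitive closure of labeled steps. -/
abbrev LPlus (R : CTRS F V) : LTerm R → LTerm R → Prop := Relation.TransGen (LRel R)

/-- The stored reductions become the premises of a success step, which charges their costs. Debts of
variables of the right-hand side survive in its instance; the remaining unpaid ones are discharged
first. -/
theorem Satisfied.success (hR : IsStrongCCTRS R) {f : F.Sym} {L : Set (R f)} {ρ : R f}
    {σ : V → LTerm R} {σ' : V → HTerm R} {δ : V → ℕ} {c : Fin ρ.1.k → ℕ}
    (h : Satisfied R ρ ρ.1.k σ σ' δ c) (hρ : ρ ∈ L) :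
    ∃ s M D, LRed R (lapp R f L fun i => (label R (ρ.1.args i)).subst σ) s M ∧
      LPlus R (lapp R f L fun i => (label R (ρ.1.args i)).subst σ) s ∧
      Sim R s ((xi R (htop R) ρ.1.rhs).subst σ') D ∧ 1 + debt ρ.1 ρ.1.k δ c ≤ M + D := by
  -- Variables used in conditions are left alone, since their debts are already accounted for and
  -- the instances of `a l` must not change.
  obtain ⟨τ, m, h1, h2, h3⟩ := exists_discharged_subst
    ((bound ρ.1 ρ.1.k \ used ρ.1 ρ.1.k) \ fvars ρ.1.rhs)
    (fun y hy => h.reaches y (Finset.mem_sdiff.1 (Finset.mem_sdiff.1 hy).1).1)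
  choose M₁ h4 h5 using fun i => LRed.pattern h1 (ρ.1.args i)
  choose M₂ h6 h7 using fun l => LRed.pattern h1 (ρ.1.b l)
  have h8 : ∀ l, LRed R ((label R (ρ.1.a l)).subst τ) ((label R (ρ.1.b l)).subst τ)
      (c l + M₂ l) := by
    intro l
    have : (label R (ρ.1.a l)).subst τ = (label R (ρ.1.a l)).subst σ := by
      refine label_subst_congr fun y hy => h2 y fun hy' => ?_
      exact (Finset.mem_sdiff.1 (Finset.mem_sdiff.1 hy').1).2 (mem_used.2 ⟨l, l.2, hy⟩)
    rw [this]
    exact (h.red l l.2).trans (h6 l)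
  have hstep : LStep R (lapp R f L fun i => (label R (ρ.1.args i)).subst τ)
      ((label R ρ.1.rhs).subst τ) _ := .success _ _ f L ρ τ _ hρ h8 .root
  have hred := LRed.app (L := L) h4
  refine ⟨_, _, ∑ y ∈ fvars ρ.1.rhs, δ y, hred.trans (.single hstep),
    .tail' hred.reflTransGen ⟨_, hstep⟩, Sim.pattern _ fun y hy => ?_, ?_⟩
  · rw [h2 y fun hy' => (Finset.mem_sdiff.1 hy').2 (mem_fvars.2 hy)]
    exact h.sim y (rhs_vars_subset_bound hR ρ hy)
  · have e1 : ∑ y ∈ bound ρ.1 ρ.1.k \ used ρ.1 ρ.1.k, δ y ≤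
        ∑ y ∈ (bound ρ.1 ρ.1.k \ used ρ.1 ρ.1.k) \ fvars ρ.1.rhs, δ y +
          ∑ y ∈ fvars ρ.1.rhs, δ y := by
      rw [← Finset.sum_union Finset.sdiff_disjoint]
      exact Finset.sum_le_sum_of_subset (by simp)
    have e2 : ∑ y ∈ (bound ρ.1 ρ.1.k \ used ρ.1 ρ.1.k) \ fvars ρ.1.rhs, δ y ≤
        ∑ y ∈ bound ρ.1 ρ.1.k, m y :=
      (Finset.sum_le_sum h3).trans (Finset.sum_le_sum_of_subset
        (Finset.sdiff_subset.trans Finset.sdiff_subset))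
    -- Each discharged variable occurs in the left-hand side, where its reduction precedes the step,
    -- or in some `b l`, where it prolongs the reduction of condition `l`.
    have e3 : ∑ y ∈ bound ρ.1 ρ.1.k, m y ≤ ∑ i, M₁ i + ∑ l, M₂ l := by
      have := Finset.sum_union_inter (f := m) (s₁ := fvars ρ.1.lhs)
        (s₂ := (Finset.univ.filter fun l : Fin ρ.1.k => l.val < ρ.1.k).biUnion
          fun l => fvars (ρ.1.b l))
      have e4 : ∑ y ∈ fvars ρ.1.lhs, m y ≤ ∑ i, M₁ i :=
        (sum_biUnion_le ..).trans (Finset.sum_le_sum fun i _ => h5 i)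
      have e5 := (sum_biUnion_le (Finset.univ.filter fun l : Fin ρ.1.k => l.val < ρ.1.k)
        (fun l => fvars (ρ.1.b l)) m).trans (Finset.sum_le_sum fun l _ => h7 l)
      have e6 : ∑ l with l.val < ρ.1.k, M₂ l ≤ ∑ l, M₂ l :=
        Finset.sum_le_sum_of_subset (Finset.subset_univ _)
      rw [bound]
      omega
    have e7 : ∑ l with l.val < ρ.1.k, c l ≤ ∑ l, c l :=
      Finset.sum_le_sum_of_subset (Finset.subset_univ _)
    rw [Finset.sum_add_distrib, debt]
    omega

/-- Starting condition `j` moves the debts of the variables of `a j` from the bound variables to the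
new active argument; the labeled term does not move. -/
theorem Satisfied.start {f : F.Sym} {L : Set (R f)} {ρ : R f} {j : Fin ρ.1.k}
    {σ : V → LTerm R} {σ' : V → HTerm R} {δ : V → ℕ} {c : Fin ρ.1.k → ℕ}
    (hR : IsStrongCCTRS R) (h : Satisfied R ρ j σ σ' δ c) (hρ : ρ ∈ L)
    {a : HPos R (.cond f ρ j) → HTerm R}
    (ha : ∀ i, a (.inl i) = (xi R (htop R) (ρ.1.args i)).subst σ')
    (he : ∀ ρ', a (.inr (.inl ρ')) = if ρ'.1 ∈ L then htop R else hbot R)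
    (hb : ∀ l, l.1 < j → a (.inr (.inr l)) = (xi R (htop R) (ρ.1.b l.1)).subst σ')
    (hj : a (.inr (.inr ⟨j, le_rfl⟩)) = (xi R (htop R) (ρ.1.a j)).subst σ') :
    Sim R (lapp R f L fun i => (label R (ρ.1.args i)).subst σ)
      (Term.app (S := HSig R) (.cond f ρ j) a) (debt ρ.1 j δ c) := by
  -- The labeled reduction for condition `j` is still empty, whatever value `c j` had before.
  refine .cond f L ρ j σ σ' δ (Function.update c j 0) _ _ a _ hρ h.sim h.reaches (fun l hl => ?_)
    ?_ (hj ▸ Sim.pattern (ρ.1.a j) fun y hy => h.sim y (a_vars_subset_bound hR ρ j hy)) ha he hb ?_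
  · rw [Function.update_of_ne hl.ne]
    exact h.red l hl
  · rw [Function.update_self]
    exact .refl _
  · have e1 : ∑ y ∈ bound ρ.1 j \ used ρ.1 j, δ y ≤
        ∑ y ∈ bound ρ.1 j \ used ρ.1 (j + 1), δ y + ∑ y ∈ fvars (ρ.1.a j), δ y := by
      refine le_trans (Finset.sum_le_sum_of_subset (t := (bound ρ.1 j \ used ρ.1 (j + 1)) ∪
        fvars (ρ.1.a j)) fun y hy => ?_) ?_
      · simp only [Finset.mem_sdiff, Finset.mem_union, mem_used, mem_fvars] at hy ⊢
        by_cases hya : y ∈ (ρ.1.a j).vars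
        · exact .inr hya
        · refine .inl ⟨hy.1, ?_⟩
          rintro ⟨l, hl, hyl⟩
          refine hy.2 ⟨l, lt_of_le_of_ne (Nat.lt_succ_iff.1 hl) fun hlj => hya ?_, hyl⟩
          rwa [← Fin.ext hlj]
      · have := Finset.sum_union_inter (f := δ) (s₁ := bound ρ.1 j \ used ρ.1 (j + 1))
          (s₂ := fvars (ρ.1.a j))
        omega
    have e2 : ∑ l with l.val < j.val, c l ≤ ∑ l ∈ Finset.Iic j, Function.update c j 0 l := by
      rw [← Finset.sum_congr rfl (f := Function.update c j 0)]
      · refine Finset.sum_le_sum_of_subset fun l hl => ?_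
        exact Finset.mem_Iic.2 (le_of_lt (Finset.mem_filter.1 hl).2)
      · intro l hl
        have hl : l < j := (Finset.mem_filter.1 hl).2
        exact Function.update_of_ne hl.ne _ _
    rw [debt]
    omega

/-- Matching the active argument against `b j` binds the variables of `b j`. They are new, so `σ`
and `δ` can be extended without disturbing the stored data. -/
theorem Sim.complete_condition (hR : IsStrongCCTRS R) {f : F.Sym} {ρ : R f} {j : Fin ρ.1.k}
    {a : HPos R (.cond f ρ j) → HTerm R} {s : LTerm R} {D : ℕ} {σ' : V → HTerm R}
    (h : Sim R s (Term.app (S := HSig R) (.cond f ρ j) a) D)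
    (hd : SubDischargeable R (Term.app (S := HSig R) (.cond f ρ j) a))
    (ha : ∀ i, a (.inl i) = (xi R (htop R) (ρ.1.args i)).subst σ')
    (hb : ∀ l, a (.inr (.inr l)) = (xi R (htop R) (ρ.1.b l.1)).subst σ') :
    ∃ (L : Set (R f)) (σ : V → LTerm R) (δ : V → ℕ) (c : Fin ρ.1.k → ℕ),
      s = lapp R f L (fun i => (label R (ρ.1.args i)).subst σ) ∧ ρ ∈ L ∧
      (∀ ρ', a (.inr (.inl ρ')) = if ρ'.1 ∈ L then htop R else hbot R) ∧
      Satisfied R ρ (j + 1) σ σ' δ c ∧ D ≤ debt ρ.1 (j + 1) δ c := by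
  cases h with
  | cond _ L _ _ σ τ δ c u e _ _ h1 h2 h3 h4 h5 h6 h7 h8 h9 h10 =>
  rw [hb] at h6
  obtain ⟨σ₁, δ₁, hm⟩ := h6.exists_matches (hR.b_constructor f ρ.1 ρ.2 j) (hR.b_linear f ρ.1 ρ.2 j)
  have hτ : ∀ y ∈ bound ρ.1 j, τ y = σ' y := by
    intro y hy
    rcases mem_bound.1 hy with hy | ⟨l, hl, hy⟩
    · obtain ⟨i, hi⟩ := Set.mem_iUnion.1 hy
      exact eq_of_xi_subst_eq ((h7 i).symm.trans (ha i)) y hi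
    · exact eq_of_xi_subst_eq ((h9 ⟨l, le_of_lt hl⟩ hl).symm.trans (hb _)) y hy
  let σ₂ : V → LTerm R := fun y => if y ∈ (ρ.1.b j).vars then σ₁ y else σ y
  let δ₂ : V → ℕ := fun y => if y ∈ (ρ.1.b j).vars then δ₁ y else δ y
  have hnb : ∀ y ∈ bound ρ.1 j, y ∉ (ρ.1.b j).vars :=
    fun y hy hy' => b_vars_not_mem_bound hR ρ j hy' le_rfl hy
  have hσ : ∀ y ∈ bound ρ.1 j, σ₂ y = σ y := fun y hy => if_neg (hnb y hy)
  have hδ : ∀ y ∈ bound ρ.1 j, δ₂ y = δ y := fun y hy => if_neg (hnb y hy)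
  have hσb : ∀ y ∈ (ρ.1.b j).vars, σ₂ y = σ₁ y := fun y hy => if_pos hy
  have hδb : ∀ y ∈ (ρ.1.b j).vars, δ₂ y = δ₁ y := fun y hy => if_pos hy
  have hbound : ∀ y, y ∈ bound ρ.1 (j + 1) ↔ y ∈ bound ρ.1 j ∨ y ∈ (ρ.1.b j).vars := by
    intro y
    rw [mem_bound, mem_bound, or_assoc]
    refine or_congr Iff.rfl ⟨?_, ?_⟩
    · rintro ⟨l, hl, hy⟩
      rcases Nat.lt_succ_iff_lt_or_eq.1 hl with hl | hl
      · exact .inl ⟨l, hl, hy⟩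
      · exact .inr (Fin.ext hl ▸ hy)
    · rintro (⟨l, hl, hy⟩ | hy)
      · exact ⟨l, Nat.lt_succ_of_lt hl, hy⟩
      · exact ⟨j, Nat.lt_succ_self _, hy⟩
  have hla : ∀ l, l ≤ j → (label R (ρ.1.a l)).subst σ₂ = (label R (ρ.1.a l)).subst σ :=
    fun l hl => label_subst_congr fun y hy =>
      hσ y (used_succ_subset_bound hR ρ j (mem_used.2 ⟨l, Nat.lt_succ_of_le hl, hy⟩))
  refine ⟨L, σ₂, δ₂, c, ?_, h1, h8, ⟨?_, ?_, ?_⟩, ?_⟩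
  · congr 1
    funext i
    refine label_subst_congr fun y hy => (hσ y ?_).symm
    exact mem_bound.2 (.inl (Set.mem_iUnion.2 ⟨i, hy⟩))
  · intro y hy
    rcases (hbound y).1 hy with hy | hy
    · rw [hσ y hy, hδ y hy, ← hτ y hy]
      exact h2 y hy
    · rw [hσb y hy, hδb y hy]
      exact hm.sim y hy
  · intro y hy
    rcases (hbound y).1 hy with hy | hy
    · rw [hσ y hy, hδ y hy]
      exact h3 y hy
    · rw [hσb y hy, hδb y hy]
      -- The newly bound values lie at active positions below the active argument, so their debts
      -- are payable.
      refine hd _ ?_ _ _ (hm.sim y hy)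
      have : ActiveArg R (a (.inr (.inr ⟨j, le_rfl⟩))) (Term.app (S := HSig R) (.cond f ρ j) a) :=
        .mk (.cond f ρ j) a (.inr (.inr ⟨j, le_rfl⟩)) rfl
      rw [hb] at this
      exact .tail' (activeSub_pattern hy) this
  · intro l hl
    rw [hla l (Nat.lt_succ_iff.1 hl)]
    rcases Nat.lt_succ_iff_lt_or_eq.1 hl with hl | hl
    · rw [label_subst_congr (σ := σ₂) (τ := σ) fun y hy => hσ y (mem_bound.2 (.inr ⟨l, hl, hy⟩))]
      exact h4 l hl
    · obtain rfl := Fin.ext hl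
      rw [label_subst_congr (σ := σ₂) (τ := σ₁) hσb, ← hm.eq]
      exact h5
  · have e1 : ∑ y ∈ bound ρ.1 (j + 1) \ used ρ.1 (j + 1), δ₂ y =
        ∑ y ∈ bound ρ.1 j \ used ρ.1 (j + 1), δ y + ∑ y ∈ fvars (ρ.1.b j), δ₁ y := by
      have e3 : ∑ y ∈ bound ρ.1 j \ used ρ.1 (j + 1), δ y =
          ∑ y ∈ bound ρ.1 j \ used ρ.1 (j + 1), δ₂ y :=
        Finset.sum_congr rfl fun y hy => (hδ y (Finset.mem_sdiff.1 hy).1).symm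
      have e4 : ∑ y ∈ fvars (ρ.1.b j), δ₁ y = ∑ y ∈ fvars (ρ.1.b j), δ₂ y :=
        Finset.sum_congr rfl fun y hy => (hδb y (mem_fvars.1 hy)).symm
      rw [e3, e4, ← Finset.sum_union]
      · refine Finset.sum_congr ?_ fun _ _ => rfl
        ext y
        simp only [Finset.mem_sdiff, Finset.mem_union, mem_fvars, hbound]
        have : y ∈ (ρ.1.b j).vars → y ∉ used ρ.1 (j + 1) := fun hy hy' =>
          hnb y (used_succ_subset_bound hR ρ j hy') hy
        tauto
      · rw [Finset.disjoint_left]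
        exact fun y hy hy' => hnb y (Finset.mem_sdiff.1 hy).1 (mem_fvars.1 hy')
    have e2 : ∑ l ∈ Finset.Iic j, c l = ∑ l with l.val < j.val + 1, c l := by
      refine Finset.sum_congr ?_ fun _ _ => rfl
      ext l
      simp only [Finset.mem_Iic, Finset.mem_filter, Finset.mem_univ, true_and, Fin.le_def,
        Nat.lt_succ_iff]
    have := hm.le
    rw [debt]
    omega

/-- The debt of the active argument is paid while preserving its clash with `b j`, and the stored
reductions then form a failed step. Debts of left-hand side variables remain in the arguments;
unused variables bound by earlier conditions disappear and must be discharged. -/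
theorem Sim.fail_condition [Infinite V] {f : F.Sym} {ρ : R f}
    {j : Fin ρ.1.k} {a : HPos R (.cond f ρ j) → HTerm R} {s : LTerm R} {D : ℕ} {σ' : V → HTerm R}
    {v : HTerm R} {es : R f → HTerm R}
    (h : Sim R s (Term.app (S := HSig R) (.cond f ρ j) a) D)
    (hd : SubDischargeable R (Term.app (S := HSig R) (.cond f ρ j) a))
    (ha : ∀ i, a (.inl i) = (xi R (htop R) (ρ.1.args i)).subst σ')
    (hv : AP R (ρ.1.b j) v) (hj : a (.inr (.inr ⟨j, le_rfl⟩)) = v.subst σ')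
    (he : ∀ ρ', a (.inr (.inl ρ')) = es ρ'.1) (hρ : es ρ = hbot R) :
    ∃ s' M D', LRed R s s' M ∧ LPlus R s s' ∧
      Sim R s' (hfn R f (fun i => (xi R (htop R) (ρ.1.args i)).subst σ') es) D' ∧
      D ≤ M + D' := by
  cases h with
  | cond _ L _ _ σ τ δ c u e _ _ h1 h2 h3 h4 h5 h6 h7 h8 h9 h10 =>
  have hact : ActiveArg R (a (.inr (.inr ⟨j, le_rfl⟩))) (Term.app (S := HSig R) (.cond f ρ j) a) :=
    .mk (.cond f ρ j) a (.inr (.inr ⟨j, le_rfl⟩)) rfl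
  have hnm : NoMatch R (ρ.1.b j) u := by
    rw [hj] at h6
    exact hv.noMatch h6
  obtain ⟨u', Mu, h11, h12, h13⟩ := hnm.discharge h6 (hd.arg hact)
  obtain ⟨p, τp, h14, h15, h16, h17, h18⟩ := h13.exists_pattern (ρ.1.b j).vars
    (Term.vars_finite (S := F) (fun f => inferInstanceAs (Finite (F.Pos f))) _)
  obtain ⟨σ₁, m, h19, h20, h21⟩ := exists_discharged_subst
    ((bound ρ.1 j \ used ρ.1 (j + 1)) \ fvars ρ.1.lhs)
    (fun y hy => h3 y (Finset.mem_sdiff.1 (Finset.mem_sdiff.1 hy).1).1)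
  choose M h22 h23 using fun l => LRed.pattern h19 (ρ.1.b l)
  have hargs : ∀ i, (label R (ρ.1.args i)).subst σ₁ = (label R (ρ.1.args i)).subst σ := by
    refine fun i => label_subst_congr fun y hy => h20 y fun hy' => ?_
    exact (Finset.mem_sdiff.1 hy').2 (mem_fvars.2 (Set.mem_iUnion.2 ⟨i, hy⟩))
  have hla : ∀ l, l ≤ j → (label R (ρ.1.a l)).subst σ₁ = (label R (ρ.1.a l)).subst σ := by
    refine fun l hl => label_subst_congr fun y hy => h20 y fun hy' => ?_
    exact (Finset.mem_sdiff.1 (Finset.mem_sdiff.1 hy').1).2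
      (mem_used.2 ⟨l, Nat.lt_succ_of_le hl, hy⟩)
  have hstep : LStep R (lapp R f L fun i => (label R (ρ.1.args i)).subst σ₁)
      (lapp R f (L \ {ρ}) fun i => (label R (ρ.1.args i)).subst σ₁)
      (∑ l ∈ Finset.Iio j, (c l + M l) + (c j + Mu)) := by
    refine .fail _ _ f L ρ σ₁ j _ _ p τp h1 (fun l hl => ?_) h15 h16 h17 h18 ?_ .root
    · rw [hla l hl.le]
      exact (h4 l hl).trans (h22 l)
    · rw [hla j le_rfl, h14]
      exact h5.trans h11
  -- No variable of the left-hand side was reduced, so the step starts at `s` itself.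
  simp only [hargs] at hstep
  have hsub : Sim R (lapp R f (L \ {ρ}) fun i => (label R (ρ.1.args i)).subst σ)
      (hfn R f (fun i => (xi R (htop R) (ρ.1.args i)).subst σ') es) (∑ y ∈ fvars ρ.1.lhs, δ y) := by
    refine (Sim.mk_hfn (d := fun i => ∑ y ∈ fvars (ρ.1.args i), δ y) (fun i => ?_) fun ρ' => ?_).mono
      (sum_biUnion_le ..)
    · rw [← ha, h7]
      exact Sim.pattern _ fun y hy => h2 y (mem_bound.2 (.inl (Set.mem_iUnion.2 ⟨i, hy⟩)))
    · by_cases hne : ρ' = ρ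
      · subst hne
        simp [hρ]
      · rw [← he ⟨ρ', hne⟩, h8]
        simp [hne]
  refine ⟨_, _, _, .single hstep, .single ⟨_, hstep⟩, hsub, ?_⟩
  have e1 : ∑ y ∈ bound ρ.1 j \ used ρ.1 (j + 1), δ y ≤
      ∑ y ∈ (bound ρ.1 j \ used ρ.1 (j + 1)) \ fvars ρ.1.lhs, δ y + ∑ y ∈ fvars ρ.1.lhs, δ y := by
    rw [← Finset.sum_union Finset.sdiff_disjoint]
    exact Finset.sum_le_sum_of_subset (by simp)
  have e2 : ∑ y ∈ (bound ρ.1 j \ used ρ.1 (j + 1)) \ fvars ρ.1.lhs, δ y ≤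
      ∑ l ∈ Finset.Iio j, M l := by
    refine (Finset.sum_le_sum h21).trans (le_trans ?_
      ((sum_biUnion_le (Finset.Iio j) (fun l => fvars (ρ.1.b l)) m).trans
        (Finset.sum_le_sum fun l _ => h23 l)))
    refine Finset.sum_le_sum_of_subset fun y hy => ?_
    simp only [Finset.mem_sdiff, mem_bound, mem_fvars, Finset.mem_biUnion, Finset.mem_Iio] at hy ⊢
    rcases hy.1.1 with h | ⟨l, hl, h⟩
    · exact absurd h hy.2
    · exact ⟨l, hl, h⟩
  have e3 : ∑ l ∈ Finset.Iic j, c l = ∑ l ∈ Finset.Iio j, c l + c j := by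
    rw [← Finset.Iio_insert, Finset.sum_insert (by simp), add_comm]
  rw [Finset.sum_add_distrib]
  omega

end RootSteps

end CondRew

-- Simulation of arbitrary steps, and matching of normal forms

namespace CondRew

noncomputable section Steps

open scoped Classical

variable {F : Signature.{u, w}} {V : Type v} {R : CTRS F V} [∀ f, Fintype (F.Pos f)]

/-- The number of conditions that remain to be evaluated at a symbol `cond f ρ j`. -/
def rankSym (R : CTRS F V) : HSym R → WithTop ℕ
  | .cond _ ρ j => ((ρ.1.k - j.val : ℕ) : WithTop ℕ)
  | _ => ⊤

/-- The rank of the root symbol. -/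
def rank (R : CTRS F V) : HTerm R → WithTop ℕ
  | .var _ => ⊤
  | .app g _ => rankSym R g

omit [∀ f, Fintype (F.Pos f)] in
theorem hcond_subst (f : F.Sym) (ρ : R f) (j : Fin ρ.1.k) (ts : F.Pos f → HTerm R)
    (es : R f → HTerm R) (cs : Fin ρ.1.k → HTerm R) (σ : V → HTerm R) :
    (hcond R f ρ j ts es cs).subst σ = hcond R f ρ j (fun i => (ts i).subst σ)
      (fun ρ' => (es ρ').subst σ) (fun l => (cs l).subst σ) := by
  simp only [hcond, Term.subst]
  congr 1
  funext i
  rcases i with i | ρ' | l <;> rfl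

omit [∀ f, Fintype (F.Pos f)] in
theorem update_subst {ι : Type*} [DecidableEq ι] (g : ι → HTerm R) (i : ι) (t : HTerm R) (σ : V → HTerm R) :
    (fun j => (Function.update g i t j).subst σ) =
      Function.update (fun j => (g j).subst σ) i (t.subst σ) := by
  funext j
  by_cases hj : j = i
  · subst hj
    simp
  · simp [hj]

theorem Sim.satisfied_zero (hR : IsStrongCCTRS R) {f : F.Sym} {ρ : R f} {s : LTerm R}
    {es : R f → HTerm R} {D : ℕ} {σ' : V → HTerm R}
    (h : Sim R s (hfn R f (fun i => (xi R (htop R) (ρ.1.args i)).subst σ') es) D)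
    (hd : SubDischargeable R (hfn R f (fun i => (xi R (htop R) (ρ.1.args i)).subst σ') es))
    (he : es ρ = htop R) :
    ∃ (L : Set (R f)) (σ : V → LTerm R) (δ : V → ℕ),
      s = lapp R f L (fun i => (label R (ρ.1.args i)).subst σ) ∧ ρ ∈ L ∧
      (∀ ρ', es ρ' = if ρ' ∈ L then htop R else hbot R) ∧
      Satisfied R ρ 0 σ σ' δ (fun _ => 0) ∧ D ≤ debt ρ.1 0 δ (fun _ => 0) := by
  obtain ⟨L, ss, d, rfl, h1, h2, h3⟩ := h.of_hfn
  have hlin := hR.lhs_linear f ρ.1 ρ.2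
  obtain ⟨σ, δ, hm⟩ := exists_matches_family hlin.2 fun i =>
    (h1 i).exists_matches (hR.args_constructor f ρ.1 ρ.2 i) (hlin.1 i)
  have hL : ρ ∈ L := by
    by_contra hρ
    have := h2 ρ
    rw [if_neg hρ, he] at this
    exact htop_ne_hbot this
  have hsim : ∀ y ∈ bound ρ.1 0, ∃ i, y ∈ (ρ.1.args i).vars := by
    intro y hy
    rcases mem_bound.1 hy with hy | ⟨l, hl, -⟩
    · exact Set.mem_iUnion.1 hy
    · exact absurd hl (Nat.not_lt_zero _)
  refine ⟨L, σ, δ, ?_, hL, h2, ⟨?_, ?_, fun l hl => absurd hl (Nat.not_lt_zero _)⟩, ?_⟩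
  · congr 1
    funext i
    exact (hm i).eq
  · intro y hy
    obtain ⟨i, hi⟩ := hsim y hy
    exact (hm i).sim y hi
  · intro y hy
    obtain ⟨i, hi⟩ := hsim y hy
    refine hd _ ?_ _ _ ((hm i).sim y hi)
    exact .tail' (activeSub_pattern hi)
      (activeArg_hfn (fun i => (xi R (htop R) (ρ.1.args i)).subst σ') es i)
  · refine h3.trans ((Finset.sum_le_sum fun i _ => (hm i).le).trans ?_)
    rw [← Finset.sum_biUnion]
    · simp [debt, bound, used, fvars, Rule.lhs]
    · intro i _ j _ hij
      rw [Function.onFun, Finset.disjoint_left]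
      intro y hy hy'
      exact Set.disjoint_left.1 (hlin.2 i j hij) (mem_fvars.1 hy) (mem_fvars.1 hy')

/-- Simulation of a step at the root. -/
theorem Sim.root_step [Infinite V] (hR : IsStrongCCTRS R) {l r : HTerm R} {n : ℕ}
    (hrule : XiRule R l r n) {σ' : V → HTerm R} {s : LTerm R} {D : ℕ}
    (h : Sim R s (l.subst σ') D) (hd : SubDischargeable R (l.subst σ')) :
    ∃ s' M D', LRed R s s' M ∧ Sim R s' (r.subst σ') D' ∧ n + D ≤ M + D' ∧
      -- Costs do not need this alternative; termination does, since starting or advancing a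
      -- condition leaves the labeled term unchanged.
      (LPlus R s s' ∨ s' = s ∧ rank R (r.subst σ') < rank R (l.subst σ')) := by
  cases hrule with
  | rule1 f ρ x hx hk =>
    simp only [hfn_subst, update_subst, htop_subst] at h hd
    obtain ⟨L, σ, δ, rfl, h1, -, h2, h3⟩ := h.satisfied_zero hR hd (by simp)
    rw [← hk] at h2 h3
    obtain ⟨s', M, D', h4, h5, h6, h7⟩ := h2.success hR h1
    exact ⟨s', M, D', h4, h6, by omega, .inl h5⟩
  | rule2 f ρ x j hx hj =>
    simp only [hfn_subst, update_subst, htop_subst] at h hd ⊢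
    obtain ⟨L, σ, δ, rfl, h1, he, h2, h3⟩ := h.satisfied_zero hR hd (by simp)
    rw [← hj] at h2 h3
    rw [hcond_subst]
    refine ⟨_, 0, _, .refl _, h2.start hR h1 (fun i => rfl) (fun ρ' => ?_) (fun l hl => ?_) rfl,
      by omega, .inr ⟨rfl, WithTop.coe_lt_top _⟩⟩
    · rw [← he, Function.update_of_ne ρ'.2]
      rfl
    · exact absurd (Fin.lt_def.1 hl) (by omega)
  | rule3 f ρ x j hx hj =>
    rw [hcond_subst] at h hd
    obtain ⟨L, σ, δ, c, rfl, h1, -, h2, h3⟩ := h.complete_condition hR hd (fun i => rfl)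
      (fun l => rfl)
    rw [hj] at h2 h3
    obtain ⟨s', M, D', h4, h5, h6, h7⟩ := h2.success hR h1
    exact ⟨s', M, D', h4, h6, by omega, .inl h5⟩
  | rule4 f ρ x j j' hx hj =>
    rw [hcond_subst] at h hd ⊢
    obtain ⟨L, σ, δ, c, rfl, h1, he, h2, h3⟩ := h.complete_condition hR hd (fun i => rfl)
      (fun l => rfl)
    rw [← hj] at h2 h3
    rw [hcond_subst]
    refine ⟨_, 0, _, .refl _, h2.start hR h1 (fun i => rfl) he (fun l hl => ?_) ?_,
      by omega, .inr ⟨rfl, ?_⟩⟩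
    · simp [hl.ne]
    · simp
    · have hlt : ρ.1.k - j'.val < ρ.1.k - j.val := by omega
      exact WithTop.coe_lt_coe.2 hlt
  | rule5 f ρ x j v hx hv hv1 hv2 hv3 =>
    simp only [hcond_subst, hfn_subst, update_subst, hbot_subst] at h hd ⊢
    obtain ⟨s', M, D', h1, h2, h3, h4⟩ := h.fail_condition (v := v)
      (es := Function.update (fun ρ' => σ' (x ρ')) ρ (hbot R)) hd (fun i => rfl) hv (by simp)
      (fun ρ' => by rw [Function.update_of_ne ρ'.2]; rfl) (by simp)
    exact ⟨s', M, D', h1, h3, by omega, .inl h2⟩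
  | rule6 f ρ x y j v hx hv hy hv' =>
    simp only [hfn_subst, update_subst, hbot_subst, htop_subst] at h hd ⊢
    obtain ⟨L, ss, d, rfl, h1, h2, h3⟩ := h.of_hfn
    have hL : ρ ∈ L := by
      by_contra hρ
      have := h2 ρ
      rw [if_neg hρ, Function.update_self] at this
      exact htop_ne_hbot this
    have hj := h1 j
    rw [Function.update_self] at hj
    have hstep := (hv.noMatch hj).lstep hL
    refine ⟨_, _, _, .single hstep, Sim.mk_hfn h1 fun ρ' => ?_, by omega, .inl (.single ⟨_, hstep⟩)⟩
    by_cases hne : ρ' = ρ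
    · subst hne
      simp
    · have := h2 ρ'
      rw [Function.update_of_ne hne] at this ⊢
      rw [this]
      simp [hne]

/-- Simulation of a step below the root. -/
theorem Sim.arg_step {g : HSym R} {a a' : HPos R g → HTerm R} {i : HPos R g} (hi : i ∈ mu R g)
    (hne : ∀ j, j ≠ i → a' j = a j) {n : ℕ} {s : LTerm R} {D : ℕ}
    (h : Sim R s (Term.app (S := HSig R) g a) D)
    (hstep : ∀ s₁ D₁, Sim R s₁ (a i) D₁ → ∃ s₂ M D₂, LRed R s₁ s₂ M ∧ Sim R s₂ (a' i) D₂ ∧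
      n + D₁ ≤ M + D₂) :
    ∃ s' M D', LRed R s s' M ∧ Sim R s' (Term.app (S := HSig R) g a') D' ∧ n + D ≤ M + D' := by
  cases h with
  | fn f L ss _ d _ h1 h2 h3 =>
    obtain ⟨i, rfl⟩ := hi
    obtain ⟨s₂, M, D₂, h4, h5, h6⟩ := hstep _ _ (h1 i)
    refine ⟨lapp R f L (Function.update ss i s₂), M, ∑ k, Function.update d i D₂ k, ?_,
      .fn f L _ _ (Function.update d i D₂) _ (fun k => ?_) (fun ρ => ?_) le_rfl, ?_⟩
    · have := LRed.update (g := (⟨f, L⟩ : (LSig R).Sym)) (i := i) ss h4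
      rwa [Function.update_eq_self] at this
    · by_cases hk : k = i
      · subst hk
        rw [Function.update_self, Function.update_self]
        exact h5
      · rw [Function.update_of_ne hk, Function.update_of_ne hk, hne _ (by simpa using hk)]
        exact h1 k
    · rw [hne _ (by simp), h2]
    · have e1 := Finset.add_sum_erase Finset.univ d (Finset.mem_univ i)
      rw [Finset.sum_update_of_mem (Finset.mem_univ i), Finset.sdiff_singleton_eq_erase]
      omega
  | cond f L ρ j σ σ' δ c u e _ _ h1 h2 h3 h4 h5 h6 h7 h8 h9 h10 =>
    obtain rfl : i = .inr (.inr ⟨j, le_rfl⟩) := hi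
    obtain ⟨u', M, e', h11, h12, h13⟩ := hstep _ _ h6
    -- The labeled redex stays put: the simulating reduction is appended to the stored one for
    -- condition `j`, and the cost `n` becomes debt.
    refine ⟨_, 0, n + D, .refl _, .cond f L ρ j σ σ' δ (Function.update c j (c j + M)) u' e' a' _
      h1 h2 h3 (fun l hl => ?_) ?_ h12 (fun i => ?_) (fun ρ' => ?_) (fun l hl => ?_) ?_, by omega⟩
    · rw [Function.update_of_ne hl.ne]
      exact h4 l hl
    · rw [Function.update_self]
      exact h5.trans h11
    · rw [hne _ (by simp), h7]
    · rw [hne _ (by simp), h8]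
    · rw [hne _ (by simpa [Subtype.ext_iff] using hl.ne), h9 l hl]
    · have e1 := Finset.add_sum_erase (Finset.Iic j) c (Finset.mem_Iic.2 le_rfl)
      rw [Finset.sum_update_of_mem (Finset.mem_Iic.2 le_rfl), Finset.sdiff_singleton_eq_erase]
      omega

/-- Simulation of a context-sensitive step. -/
theorem Sim.step [Infinite V] (hR : IsStrongCCTRS R) {t t' : HTerm R} {n : ℕ}
    (hstep : XiStep R t t' n) {s : LTerm R} {D : ℕ} (h : Sim R s t D)
    (hd : SubDischargeable R t) :
    ∃ s' M D', LRed R s s' M ∧ Sim R s' t' D' ∧ n + D ≤ M + D' := by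
  obtain ⟨l, r, σ', hrule, hrep⟩ := hstep
  induction hrep generalizing s D with
  | root =>
    obtain ⟨s', M, D', h1, h2, h3, -⟩ := h.root_step hR hrule hd
    exact ⟨s', M, D', h1, h2, h3⟩
  | arg g a a' i hi _ hne ih =>
    exact h.arg_step hi hne fun s₁ D₁ h₁ => ih h₁ (hd.arg (.mk g a i hi))

omit [∀ f, Fintype (F.Pos f)] in
theorem XiStep.arg {g : HSym R} {a : HPos R g → HTerm R} {i : HPos R g} (hi : i ∈ mu R g)
    {t : HTerm R} {n : ℕ} (h : XiStep R (a i) t n) :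
    XiStep R (Term.app (S := HSig R) g a) (Term.app (S := HSig R) g (Function.update a i t)) n := by
  obtain ⟨l, r, σ', hrule, hrep⟩ := h
  refine ⟨l, r, σ', hrule, Term.Replace.arg (S := HSig R) g a (Function.update a i t) i hi ?_
    fun j hj => Function.update_of_ne hj _ _⟩
  rwa [Function.update_self]

/-! ### Normal forms -/

/-- Ground labeled normal forms. -/
inductive Value (R : CTRS F V) : LTerm R → Prop
  | mk (f : F.Sym) (us : F.Pos f → LTerm R) : (∀ i, Value R (us i)) → Value R (lapp R f ∅ us)

-- Linearity is essential: without clashes in the arguments, their matching substitutions can be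
-- glued.
omit [∀ f, Fintype (F.Pos f)] in
theorem Value.match_or_noMatch {p : Term F V} (hc : ConstructorTerm R p) (hl : p.Linear)
    {s : LTerm R} (hs : Value R s) : (∃ σ, s = (label R p).subst σ) ∨ NoMatch R p s := by
  induction p generalizing s with
  | var x => exact .inl ⟨fun _ => s, rfl⟩
  | app f ts ih =>
    obtain ⟨g, us, hus⟩ := hs
    by_cases hg : g = f
    · subst hg
      by_cases hn : ∃ i, NoMatch R (ts i) (us i)
      · obtain ⟨i, hi⟩ := hn
        exact .inr (.arg _ _ _ i hi)
      · choose σ hσ using fun i =>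
          (ih i (hc.2 i) (hl.1 i) (hus i)).resolve_right fun h => hn ⟨i, h⟩
        obtain ⟨τ, hτ⟩ := exists_glue (fun i => (ts i).vars) σ hl.2 (fun y => .var y)
        have hL : (∅ : Set (R g)) = Set.univ := by
          ext ρ
          exact absurd ⟨_, ρ.2⟩ hc.1
        refine .inl ⟨τ, ?_⟩
        simp only [label, Term.subst]
        rw [← hL]
        congr 1
        funext i
        rw [hσ i]
        exact label_subst_congr fun y hy => (hτ i y hy).symm
    · exact .inr (.root _ _ _ _ hg)

theorem hsig_finitary (hR : IsStrongCCTRS R) : (HSig R).Finitary := by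
  intro g
  cases g with
  | bot => exact inferInstanceAs (Finite PEmpty)
  | top => exact inferInstanceAs (Finite PEmpty)
  | fn f =>
    have := (hR.semifinite f).to_subtype
    exact inferInstanceAs (Finite (F.Pos f ⊕ R f))
  | cond f ρ j =>
    have := (hR.semifinite f).to_subtype
    exact inferInstanceAs (Finite (F.Pos f ⊕ ({ρ' : R f // ρ' ≠ ρ} ⊕ {l : Fin ρ.1.k // l ≤ j})))

/-- Retain the path to the clash, with `⊥` for the empty labels, and put fresh variables beside it.
This shows that rules 5 and 6 cover every failure of a normal form to match. -/
theorem NoMatch.exists_antipattern [Infinite V] (hR : IsStrongCCTRS R) {p : Term F V} {s : LTerm R}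
    (h : NoMatch R p s) (A : Set V) (hA : A.Finite) :
    ∃ v σ', AP R p v ∧ v.subst σ' = zeta R s ∧ Disjoint v.vars A := by
  induction h with
  | root f ts g us hg =>
    obtain ⟨x, hx, hxA⟩ := exists_fresh_family (F.Pos g) A hA
    refine ⟨_, Function.extend x (fun i => zeta R (us i)) (fun y => .var y),
      .other f ts g x hg hx, ?_, ?_⟩
    · simp only [hfn_subst, hbot_subst, Term.subst, hx.extend_apply, zeta,
        Set.mem_empty_iff_false, if_false]
    · rw [Set.disjoint_left]
      intro y hy
      obtain ⟨i | ρ, hi⟩ := Set.mem_iUnion.1 hy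
      · cases hi
        exact hxA i
      · exact (Set.mem_iUnion.1 hi).choose.elim
  | arg f ts us i hi ih =>
    obtain ⟨u, τ, h1, h2, h3⟩ := ih
    obtain ⟨x, hx, hxA⟩ := exists_fresh_family (F.Pos f) (u.vars ∪ A)
      ((Term.vars_finite (hsig_finitary hR) u).union hA)
    have hu : u.subst (Function.extend x (fun i => zeta R (us i)) τ) = zeta R (us i) := by
      rw [← h2]
      refine Term.subst_congr _ fun y hy => Function.extend_apply' _ _ _ ?_
      rintro ⟨k, rfl⟩
      exact hxA k (.inl hy)
    refine ⟨_, Function.extend x (fun i => zeta R (us i)) τ,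
      .arg f ts i u x h1 hx fun j hj => hxA j (.inl hj), ?_, ?_⟩
    · simp only [hfn_subst, update_subst, hbot_subst, Term.subst, hx.extend_apply, zeta,
        Set.mem_empty_iff_false, if_false, hu, Function.update_eq_self]
    · rw [Set.disjoint_left]
      intro y hy
      obtain ⟨j | ρ, hj⟩ := Set.mem_iUnion.1 hy
      · by_cases hji : j = i
        · subst hji
          rw [Sum.elim_inl, Function.update_self] at hj
          exact Set.disjoint_left.1 h3 hj
        · rw [Sum.elim_inl, Function.update_of_ne hji] at hj
          cases hj
          exact fun h => hxA j (.inr h)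
      · exact (Set.mem_iUnion.1 hj).choose.elim

end Steps

end CondRew

-- Progress and termination

namespace CondRew

noncomputable section Termination

open scoped Classical

variable {F : Signature.{u, w}} {V : Type v} {R : CTRS F V} [∀ f, Fintype (F.Pos f)]

theorem exists_freshFor [Infinite V] (hR : IsStrongCCTRS R) {f : F.Sym} (ρ : R f) (A : Set V)
    (hA : A.Finite) : ∃ x, FreshFor R f ρ x ∧ ∀ ρ', x ρ' ∉ A := by
  have hfin : ∀ p : Term F V, p.vars.Finite :=
    Term.vars_finite (S := F) fun f => inferInstanceAs (Finite (F.Pos f))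
  have := (hR.semifinite f).to_subtype
  obtain ⟨x, hx, hxA⟩ := exists_fresh_family (R f)
    ((ρ.1.lhs.vars ∪ ⋃ i, (ρ.1.b i).vars) ∪ A)
    (((hfin _).union (Set.finite_iUnion fun i => hfin _)).union hA)
  exact ⟨x, ⟨hx, fun ρ' => ⟨fun h => hxA ρ' (.inl (.inl h)),
    fun i h => hxA ρ' (.inl (.inr (Set.mem_iUnion.2 ⟨i, h⟩)))⟩⟩, fun ρ' h => hxA ρ' (.inr h)⟩

omit [∀ f, Fintype (F.Pos f)] in
theorem xiStep_of_rule {l r t : HTerm R} {n : ℕ} (h : XiRule R l r n) {σ : V → HTerm R}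
    (ht : t = l.subst σ) : ∃ t' n, XiStep R t t' n :=
  ⟨r.subst σ, n, l, r, σ, h, ht ▸ .root⟩

omit [∀ f, Fintype (F.Pos f)] in
theorem app_fn_eq_hfn {f : F.Sym} {a : HPos R (.fn f) → HTerm R} {ts : F.Pos f → HTerm R}
    {es : R f → HTerm R} (h1 : ∀ i, a (.inl i) = ts i) (h2 : ∀ ρ, a (.inr ρ) = es ρ) :
    Term.app (S := HSig R) (.fn f) a = hfn R f ts es := by
  rw [hfn]
  congr 1
  funext i
  rcases i with i | ρ
  · exact h1 i
  · exact h2 ρ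

omit [∀ f, Fintype (F.Pos f)] in
theorem app_cond_eq_hcond {f : F.Sym} {ρ : R f} {j : Fin ρ.1.k}
    {a : HPos R (.cond f ρ j) → HTerm R} {ts : F.Pos f → HTerm R} {es : R f → HTerm R}
    {cs : Fin ρ.1.k → HTerm R} (h1 : ∀ i, a (.inl i) = ts i)
    (h2 : ∀ ρ', a (.inr (.inl ρ')) = es ρ'.1) (h3 : ∀ l, a (.inr (.inr l)) = cs l.1) :
    Term.app (S := HSig R) (.cond f ρ j) a = hcond R f ρ j ts es cs := by
  rw [hcond]
  congr 1
  funext i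
  rcases i with i | ρ' | l
  · exact h1 i
  · exact h2 ρ'
  · exact h3 l

theorem progress_fn [Infinite V] (hR : IsStrongCCTRS R) {f : F.Sym} {L : Set (R f)} {ρ : R f}
    (hρ : ρ ∈ L) {ss : F.Pos f → LTerm R} (hss : ∀ i, Value R (ss i))
    {a : HPos R (.fn f) → HTerm R} (ha : ∀ i, a (.inl i) = zeta R (ss i))
    (he : ∀ ρ, a (.inr ρ) = if ρ ∈ L then htop R else hbot R) :
    ∃ t' n, XiStep R (Term.app (S := HSig R) (.fn f) a) t' n := by
  have hlin := hR.lhs_linear f ρ.1 ρ.2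
  have hfin := (hR.semifinite f).to_subtype
  by_cases hn : ∃ i, NoMatch R (ρ.1.args i) (ss i)
  · obtain ⟨j, hj⟩ := hn
    obtain ⟨v, τ, h1, h2, -⟩ := hj.exists_antipattern hR ∅ Set.finite_empty
    obtain ⟨x, hx, hxv⟩ := exists_fresh_family (F.Pos f ⊕ R f) v.vars
      (Term.vars_finite (hsig_finitary hR) v)
    have hinj : Function.Injective (Sum.elim (fun i => x (.inl i)) (fun ρ => x (.inr ρ))) := by
      convert hx using 1
      funext i
      rcases i with i | ρ <;> rfl
    refine xiStep_of_rule (.rule6 f ρ (fun ρ => x (.inr ρ)) (fun i => x (.inl i)) j v hinj h1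
      (fun i => hxv _) (fun ρ => hxv _)) (σ := Function.extend x a τ) ?_
    rw [hfn_subst]
    refine app_fn_eq_hfn (fun i => ?_) fun ρ' => ?_
    · by_cases hi : i = j
      · subst hi
        rw [Function.update_self, ha, ← h2]
        refine Term.subst_congr _ fun y hy => (Function.extend_apply' _ _ _ ?_).symm
        rintro ⟨k, rfl⟩
        exact hxv k hy
      · rw [Function.update_of_ne hi]
        exact (hx.extend_apply _ _ (Sum.inl i)).symm
    · by_cases hi : ρ' = ρ
      · subst hi
        rw [Function.update_self, htop_subst, he, if_pos hρ]
      · rw [Function.update_of_ne hi]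
        exact (hx.extend_apply _ _ (Sum.inr ρ')).symm
  · choose σ hσ using fun i => ((hss i).match_or_noMatch (hR.args_constructor f ρ.1 ρ.2 i)
      (hlin.1 i)).resolve_right fun h => hn ⟨i, h⟩
    obtain ⟨τ, hτ⟩ := exists_glue (fun i => (ρ.1.args i).vars) σ hlin.2 (fun y => .var y)
    obtain ⟨x, hx, -⟩ := exists_freshFor hR ρ ∅ Set.finite_empty
    have ht : Term.app (S := HSig R) (.fn f) a =
        (hfn R f (fun i => xi R (htop R) (ρ.1.args i))
          (Function.update (fun ρ' => .var (x ρ')) ρ (htop R))).subst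
          (Function.extend x (fun ρ' => a (.inr ρ')) fun y => zeta R (τ y)) := by
      rw [hfn_subst]
      refine app_fn_eq_hfn (fun i => ?_) fun ρ' => ?_
      · rw [ha, hσ, zeta_label_subst]
        refine xi_subst_congr fun y hy => ?_
        rw [Function.extend_apply', hτ i y hy]
        rintro ⟨k, rfl⟩
        exact (hx.2 k).1 (Set.mem_iUnion.2 ⟨i, hy⟩)
      · by_cases hi : ρ' = ρ
        · subst hi
          rw [Function.update_self, htop_subst, he, if_pos hρ]
        · rw [Function.update_of_ne hi]
          rw [Term.subst, hx.1.extend_apply]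
    rcases Nat.eq_zero_or_pos ρ.1.k with hk | hk
    · exact xiStep_of_rule (.rule1 f ρ x hx hk) ht
    · exact xiStep_of_rule (.rule2 f ρ x ⟨0, hk⟩ hx rfl) ht

theorem progress_cond [Infinite V] (hR : IsStrongCCTRS R) {f : F.Sym} {L : Set (R f)} {ρ : R f}
    {j : Fin ρ.1.k} {σ' : V → HTerm R} {u : LTerm R} (hu : Value R u)
    {a : HPos R (.cond f ρ j) → HTerm R} (hj : a (.inr (.inr ⟨j, le_rfl⟩)) = zeta R u)
    (ha : ∀ i, a (.inl i) = (xi R (htop R) (ρ.1.args i)).subst σ')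
    (he : ∀ ρ', a (.inr (.inl ρ')) = if ρ'.1 ∈ L then htop R else hbot R)
    (hb : ∀ l, l.1 < j → a (.inr (.inr l)) = (xi R (htop R) (ρ.1.b l.1)).subst σ') :
    ∃ t' n, XiStep R (Term.app (S := HSig R) (.cond f ρ j) a) t' n := by
  rcases hu.match_or_noMatch (hR.b_constructor f ρ.1 ρ.2 j) (hR.b_linear f ρ.1 ρ.2 j) with
    ⟨τ, rfl⟩ | hn
  · obtain ⟨x, hx, -⟩ := exists_freshFor hR ρ ∅ Set.finite_empty
    -- `θ` combines three parts: the additional arguments on the fresh `x`, the new match on the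
    -- variables of `b j`, and the stored substitution on those bound earlier.
    let θ : V → HTerm R := Function.extend x (fun ρ' => if ρ' ∈ L then htop R else hbot R)
      fun y => if y ∈ (ρ.1.b j).vars then zeta R (τ y) else σ' y
    have ht : Term.app (S := HSig R) (.cond f ρ j) a =
        (hcond R f ρ j (fun i => xi R (htop R) (ρ.1.args i)) (fun ρ' => .var (x ρ'))
          (fun l => xi R (htop R) (ρ.1.b l))).subst θ := by
      rw [hcond_subst]
      refine app_cond_eq_hcond (fun i => ?_) (fun ρ' => ?_) (fun l => ?_)
      · rw [ha]
        refine xi_subst_congr fun y hy => ?_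
        have hy' : y ∈ ρ.1.lhs.vars := Set.mem_iUnion.2 ⟨i, hy⟩
        simp only [θ]
        rw [Function.extend_apply', if_neg]
        · exact Set.disjoint_left.1 (hR.lhs_disjoint f ρ.1 ρ.2 j) hy'
        · rintro ⟨k, rfl⟩
          exact (hx.2 k).1 hy'
      · simp only [he, θ, Term.subst, hx.1.extend_apply]
      · obtain ⟨l, hl⟩ := l
        have hne : ∀ y ∈ (ρ.1.b l).vars, ¬ ∃ k, x k = y := by
          rintro y hy ⟨k, rfl⟩
          exact (hx.2 k).2 l hy
        rcases hl.lt_or_eq with hlj | rfl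
        · rw [hb _ hlj]
          refine xi_subst_congr fun y hy => ?_
          simp only [θ]
          rw [Function.extend_apply' _ _ _ (hne y hy), if_neg]
          exact Set.disjoint_left.1 (hR.b_disjoint f ρ.1 ρ.2 l j hlj.ne) hy
        · rw [hj, zeta_label_subst]
          refine xi_subst_congr fun y hy => ?_
          simp only [θ]
          rw [Function.extend_apply' _ _ _ (hne y hy), if_pos hy]
    by_cases hk : j.val + 1 = ρ.1.k
    · exact xiStep_of_rule (.rule3 f ρ x j hx hk) ht
    · exact xiStep_of_rule (.rule4 f ρ x j ⟨j.val + 1, by omega⟩ hx rfl) ht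
  · have hfin : ∀ p : Term F V, p.vars.Finite :=
      Term.vars_finite (S := F) fun f => inferInstanceAs (Finite (F.Pos f))
    obtain ⟨v, τ, h1, h2, h3⟩ := hn.exists_antipattern hR (ρ.1.lhs.vars ∪ ⋃ i, (ρ.1.b i).vars)
      ((hfin _).union (Set.finite_iUnion fun i => hfin _))
    rw [Set.disjoint_union_right, Set.disjoint_iUnion_right] at h3
    obtain ⟨x, hx, hxv⟩ := exists_freshFor hR ρ v.vars (Term.vars_finite (hsig_finitary hR) v)
    refine xiStep_of_rule (.rule5 f ρ x j v hx h1 h3.1 h3.2 hxv)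
      (σ := Function.extend x (fun ρ' => if ρ' ∈ L then htop R else hbot R)
        fun y => if y ∈ v.vars then τ y else σ' y) ?_
    rw [hcond_subst]
    refine app_cond_eq_hcond (fun i => ?_) (fun ρ' => ?_) (fun l => ?_)
    · rw [ha]
      refine xi_subst_congr fun y hy => ?_
      have hy' : y ∈ ρ.1.lhs.vars := Set.mem_iUnion.2 ⟨i, hy⟩
      rw [Function.extend_apply', if_neg]
      · exact fun h => Set.disjoint_left.1 h3.1 h hy'
      · rintro ⟨k, rfl⟩
        exact (hx.2 k).1 hy'
    · simp only [he, Term.subst, hx.1.extend_apply]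
    · obtain ⟨l, hl⟩ := l
      rcases hl.lt_or_eq with hlj | rfl
      · rw [hb _ hlj, Function.update_of_ne hlj.ne]
        refine xi_subst_congr fun y hy => ?_
        rw [Function.extend_apply', if_neg]
        · exact fun h => Set.disjoint_left.1 (h3.2 l) h hy
        · rintro ⟨k, rfl⟩
          exact (hx.2 k).2 l hy
      · rw [hj, Function.update_self, ← h2]
        refine Term.subst_congr _ fun y hy => ?_
        rw [Function.extend_apply', if_pos hy]
        rintro ⟨k, rfl⟩
        exact hxv k hy

/-- A term that represents a labeled term is the translation of a ground labeled normal form, or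
it can be rewritten. -/
theorem Sim.progress [Infinite V] (hR : IsStrongCCTRS R) {s : LTerm R} {t : HTerm R} {D : ℕ}
    (h : Sim R s t D) :
    (Value R s ∧ t = zeta R s ∧ D = 0) ∨ ∃ t' n, XiStep R t t' n := by
  induction h with
  | fn f L ss a d D _ h2 h3 ih =>
    by_cases hs : ∃ i t' n, XiStep R (a (.inl i)) t' n
    · obtain ⟨i, t', n, hs⟩ := hs
      exact .inr ⟨_, _, hs.arg (g := .fn f) (i := .inl i) ⟨i, rfl⟩⟩
    have hv := fun i => (ih i).resolve_right fun h => hs ⟨i, h⟩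
    rcases L.eq_empty_or_nonempty with rfl | ⟨ρ, hρ⟩
    · refine .inl ⟨.mk f ss fun i => (hv i).1, ?_, ?_⟩
      · rw [zeta]
        exact app_fn_eq_hfn (fun i => (hv i).2.1) h2
      · simpa [fun i => (hv i).2.2] using h3
    · exact .inr (progress_fn hR hρ (fun i => (hv i).1) (fun i => (hv i).2.1) h2)
  | cond f L ρ j σ σ' δ c u e a D _ _ _ _ _ _ h7 h8 h9 _ _ ih =>
    refine .inr ?_
    rcases ih with ⟨hu, hj, -⟩ | ⟨t', n, hs⟩
    · exact progress_cond hR hu hj h7 h8 h9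
    · exact ⟨_, _, hs.arg (g := .cond f ρ j) rfl⟩

/-! ### Accessibility -/

/-- The converse of context-sensitive steps. -/
def XiInv (R : CTRS F V) (t' t : HTerm R) : Prop := ∃ n, XiStep R t t' n

/-- The converse of context-sensitive steps, and active arguments. -/
def XiSub (R : CTRS F V) (t' t : HTerm R) : Prop := XiInv R t' t ∨ ActiveArg R t' t

-- Steps of an active argument lift to the whole term, so alternating steps and descents into active
-- arguments cannot continue forever.
omit [∀ f, Fintype (F.Pos f)] in
theorem acc_xiSub {t : HTerm R} (h : Acc (XiInv R) t) : Acc (XiSub R) t := by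
  have key : ∀ t : HTerm R, (∀ t', XiInv R t' t → Acc (XiSub R) t') → Acc (XiSub R) t := by
    intro t
    induction t with
    | var x =>
      refine fun ht => ⟨_, ?_⟩
      rintro t' (h | h)
      · exact ht t' h
      · cases h
    | app g a ih =>
      refine fun ht => ⟨_, ?_⟩
      rintro t' (h | h)
      · exact ht t' h
      · obtain ⟨_, _, i, hi⟩ := h
        refine ih i fun t' ⟨n, hn⟩ => ?_
        have h1 := ht _ ⟨n, hn.arg (g := g) hi⟩
        have h2 : ActiveArg R (Function.update a i t' i)
          (Term.app (S := HSig R) g (Function.update a i t')) := .mk _ _ _ hi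
        rw [Function.update_self] at h2
        exact h1.inv (.inr h2)
  induction h with
  | intro t _ ih => exact key t ih

/-- The initial debt is paid along with the cost of the given reduction. -/
theorem Sim.exists_lred [Infinite V] (hR : IsStrongCCTRS R) {t : HTerm R}
    (ht : Acc (Relation.TransGen (XiSub R)) t) {s : LTerm R} {D : ℕ} (h : Sim R s t D)
    {t' : HTerm R} {N : ℕ} (hred : XiRed R t t' N) :
    ∃ s' M, LRed R s s' M ∧ N + D ≤ M := by
  induction ht generalizing s D t' N with
  | intro t _ ih =>
    -- Proper active subterms are smaller in the well-founded order; the induction hypothesis for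
    -- the empty reduction pays their debts.
    have hd : SubDischargeable R t := fun u hu s₁ d₁ h₁ => by
      obtain ⟨s', M, h2, h3⟩ := ih u (hu.lift id fun _ _ h => .inr h) h₁ (.refl _)
      exact ⟨s', M, h2, by omega⟩
    have hstep : ∀ t₁ t₂ m n, XiStep R t t₁ m → XiRed R t₁ t₂ n →
        ∃ s' M, LRed R s s' M ∧ m + n + D ≤ M := by
      intro t₁ t₂ m n h1 h2
      obtain ⟨s₁, M₁, D₁, h3, h4, h5⟩ := h.step hR h1 hd
      obtain ⟨s₂, M₂, h6, h7⟩ := ih t₁ (.single (.inl ⟨m, h1⟩)) h4 h2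
      exact ⟨s₂, _, h3.trans h6, by omega⟩
    cases hred with
    | refl =>
      -- If the given reduction has ended, it is prolonged by arbitrary steps until a normal form is
      -- reached, where no debt is left.
      rcases h.progress hR with ⟨-, -, rfl⟩ | ⟨t₁, n, h1⟩
      · exact ⟨s, 0, .refl _, le_rfl⟩
      · obtain ⟨s', M, h2, h3⟩ := hstep t₁ t₁ n 0 h1 (.refl _)
        exact ⟨s', M, h2, by omega⟩
    | head _ t₁ _ m n h1 h2 => exact hstep t₁ _ m n h1 h2

theorem dischargeable_of_acc [Infinite V] (hR : IsStrongCCTRS R) {t : HTerm R}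
    (ht : Acc (XiSub R) t) : Dischargeable R t := fun s d h => by
  obtain ⟨s', M, h2, h3⟩ := h.exists_lred hR ht.transGen (.refl _)
  exact ⟨s', M, h2, by omega⟩

/-- The converse of labeled steps and of steps into conditions. -/
def LInv (R : CTRS F V) (s' s : LTerm R) : Prop := (∃ n, LStep R s s' n) ∨ LCondStep R s s'

/-- The converse of labeled steps and of steps into conditions, and arguments. -/
def LSub (R : CTRS F V) (s' s : LTerm R) : Prop :=
  LInv R s' s ∨ ∃ (g : (LSig R).Sym) (ss : (LSig R).Pos g → LTerm R) (i : (LSig R).Pos g),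
    s = .app g ss ∧ s' = ss i

-- Both labeled steps and steps into conditions from an argument are available from the whole term:
-- the former lift to it, the latter have the same target.
omit [∀ f, Fintype (F.Pos f)] in
theorem acc_lSub {s : LTerm R} (h : Acc (LInv R) s) : Acc (LSub R) s := by
  have key : ∀ s : LTerm R, (∀ s', LInv R s' s → Acc (LSub R) s') → Acc (LSub R) s := by
    intro s
    induction s with
    | var x =>
      refine fun hs => ⟨_, ?_⟩
      rintro s' (h | ⟨g, ss, i, h, -⟩)
      · exact hs s' h
      · cases h
    | app g ss ih =>
      refine fun hs => ⟨_, ?_⟩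
      rintro s' (h | ⟨g', ss', i, h, rfl⟩)
      · exact hs s' h
      · cases h
        refine ih i fun s' h => ?_
        rcases h with ⟨n, h⟩ | ⟨f, L, ρ, σ, j, h1, h2, h3, h4⟩
        · have h1 := hs (.app g (Function.update ss i s')) (.inl ⟨n, LStep.arg (i := i)
            (by rwa [Function.update_self]) fun j hj => Function.update_of_ne hj _ _⟩)
          exact h1.inv (.inr ⟨g, Function.update ss i s', i, rfl, by rw [Function.update_self]⟩)
        · exact hs s' (.inr ⟨f, L, ρ, σ, j, h1, .arg _ _ i h2, h3, h4⟩)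
  induction h with
  | intro s _ ih => exact key s ih

omit [∀ f, Fintype (F.Pos f)] in
theorem LPlus.lSub {s s' : LTerm R} (h : LPlus R s s') : Relation.TransGen (LSub R) s' s :=
  (h.lift (p := fun a b => LSub R b a) id fun _ _ h => .inl (.inl h)).swap

/-- An active argument is represented by an argument of `s` or, below `cond f ρ j`, by a term
reached from the left-hand side of condition `j`, which is a step into a condition away from `s`. -/
theorem Sim.acc_arg {s : LTerm R}
    (ih : ∀ s', Relation.TransGen (LSub R) s' s → ∀ t D, Sim R s' t D → Acc (XiInv R) t)
    {g : HSym R} {a : HPos R g → HTerm R} {D : ℕ} (h : Sim R s (Term.app (S := HSig R) g a) D)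
    {i : HPos R g} (hi : i ∈ mu R g) : Acc (XiInv R) (a i) := by
  cases h with
  | fn f L ss _ d _ h1 h2 h3 =>
    obtain ⟨i, rfl⟩ := hi
    exact ih (ss i) (.single (.inr ⟨⟨f, L⟩, ss, i, rfl, rfl⟩)) _ _ (h1 i)
  | cond f L ρ j σ σ' δ c u e _ _ h1 h2 h3 h4 h5 h6 h7 h8 h9 h10 =>
    obtain rfl : i = .inr (.inr ⟨j, le_rfl⟩) := hi
    have hc : LSub R ((label R (ρ.1.a j)).subst σ)
        (lapp R f L fun i => (label R (ρ.1.args i)).subst σ) :=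
      .inl (.inr ⟨f, L, ρ, σ, j, h1, .refl, fun l hl => ⟨_, h4 l hl⟩, rfl⟩)
    refine ih u ?_ _ _ h6
    rcases Relation.reflTransGen_iff_eq_or_transGen.1 h5.reflTransGen with rfl | h
    · exact .single hc
    · exact (LPlus.lSub h).tail hc

theorem Sim.acc [Infinite V] (hR : IsStrongCCTRS R) {s : LTerm R}
    (hs : Acc (Relation.TransGen (LSub R)) s) : ∀ t D, Sim R s t D → Acc (XiInv R) t := by
  induction hs with
  | intro s _ ih =>
    -- Inside the induction on `s`: induction on the rank of the root, then on the tuple of active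
    -- arguments. The debt is irrelevant to the order and is generalized.
    suffices H : ∀ (r : WithTop ℕ) (t : HTerm R) (D : ℕ), rank R t = r → Sim R s t D →
        Acc (XiInv R) t from fun t D h => H _ t D rfl h
    intro r
    induction r using WellFoundedLT.induction with
    | ind r ihr =>
    intro t D hr h
    cases t with
    | var x => cases h
    | app g a =>
    have := hsig_finitary hR g
    have hacc := acc_tuple (XiInv R) (mu R g) (Set.toFinite _) a fun i hi => h.acc_arg ih hi
    induction hacc generalizing D with
    | intro a _ iha =>
      -- Termination of the whole term is not yet known; that of its active arguments suffices for
      -- paying debts.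
      have hd : SubDischargeable R (Term.app (S := HSig R) g a) := by
        intro u hu
        obtain ⟨b, hb1, hb2⟩ := Relation.TransGen.tail'_iff.1 hu
        obtain ⟨_, _, i, hi⟩ := hb2
        have h1 := acc_xiSub (h.acc_arg ih hi)
        rcases Relation.reflTransGen_iff_eq_or_transGen.1 hb1 with h2 | h2
        · exact dischargeable_of_acc hR (h2 ▸ h1)
        · have := h1.transGen.inv (h2.lift (p := XiSub R) id fun _ _ h => .inr h)
          exact dischargeable_of_acc hR (acc_transGen_iff.1 this)
      refine ⟨_, ?_⟩
      rintro t' ⟨n, hstep⟩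
      have hstep' := hstep
      obtain ⟨l, r', σ', hrule, hrep⟩ := hstep
      generalize hl : l.subst σ' = l₁ at hrep
      generalize hr' : r'.subst σ' = r₁ at hrep
      cases hrep with
      | root =>
        rw [← hl] at h hd
        obtain ⟨s', M, D', h1, h2, h3, h4 | ⟨rfl, h4⟩⟩ := h.root_step hR hrule hd
        · exact ih s' (LPlus.lSub h4) _ _ (hr' ▸ h2)
        · exact ihr _ (by rw [← hr, ← hl]; exact h4) _ D' (by rw [hr']) (hr' ▸ h2)
      | arg _ _ a' i hi hrep hne =>
        obtain ⟨s', M, D', h1, h2, h3⟩ := h.step hR hstep' hd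
        rcases Relation.reflTransGen_iff_eq_or_transGen.1 h1.reflTransGen with h4 | h4
        · subst h4
          exact iha a' ⟨i, hi, ⟨n, l, r', σ', hrule, by rw [hl, hr']; exact hrep⟩, hne⟩ D' hr h2
        · exact ih s' (LPlus.lSub h4) _ _ h2

end Termination

end CondRew

theorem mainTheorem1 {F : CondRew.Signature.{u, w}} {V : Type v} [Infinite V]
    (hF : F.Finitary) (R : CondRew.CTRS F V) (hR : CondRew.IsStrongCCTRS R)
    (s : CondRew.LTerm R) (hs : s.Ground) :
    (CondRew.XiTerminating R (CondRew.zeta R s) →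
      ∀ (t : CondRew.HTerm R) (N : ℕ), CondRew.XiRed R (CondRew.zeta R s) t N →
        ∃ (t' : CondRew.LTerm R) (M : ℕ), CondRew.LRed R s t' M ∧ N ≤ M) ∧
    (CondRew.XiInfinite R (CondRew.zeta R s) → CondRew.LInfinite R s) := by
  have hfin : ∀ f, Finite (F.Pos f) := hF
  let _ : ∀ f, Fintype (F.Pos f) := fun f => Fintype.ofFinite _
  have hsim := CondRew.Sim.of_ground hs
  refine ⟨fun hterm t N hred => ?_, fun hinf => ?_⟩
  · have hacc : Acc (CondRew.XiInv R) (CondRew.zeta R s) := by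
      by_contra h
      exact hterm (not_acc_iff_exists_descending_chain.1 h)
    exact hsim.exists_lred hR (CondRew.acc_xiSub hacc).transGen hred
  · by_contra h
    have hacc : Acc (CondRew.LInv R) s := by
      by_contra h'
      exact h (not_acc_iff_exists_descending_chain.1 h')
    exact not_acc_iff_exists_descending_chain (r := CondRew.XiInv R).2 hinf
      (CondRew.Sim.acc hR (CondRew.acc_lSub hacc).transGen _ _ hsim)
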